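/- Let $d\ge 1$. For each finite non-empty $A\subset\mathbb Z^d$ let $p_A\in[0,1)$, and let $(X_A)_A$ be independent Bernoulli random variables on a probability space, with $\mathbb P(X_A=1)=p_A$. Suppose that the probabilities are translation invariant, i.e. $p_{A+v}=p_A$ for all $A$ and all $v\in\mathbb Z^d$, and that $$\sum_{A\ni 0} p_A e^{\lambda |A|}<\infty\qquad\text{for every }\lambda>0 ,$$ the sum being over the finite sets $A\subset\mathbb Z^d$ that contain $0$. Let $$\bar X:=\bigcup\{A : X_A=1\},\qquad \hat X_v:=\{A\ni 0 : X_{A+v}=1\}\quad(v\in\mathbb Z^d),$$ where $A$ ranges over finite subsets of $\mathbb Z^d$. Regard $\bar X$ as a $\{0,1\}$-valued process on $\mathbb Z^d$. Then $\bar X$ is a finitary factor of an IID process. Moreover, almost surely $\hat X_v$ is finite for all $v$, and the process $\hat X=(\hat X_v)_{v\in\mathbb Z^d}$, with values in the countable set of finite collections of finite subsets of $\mathbb Z^d$ containing $0$ (with its discrete $\sigma$-algebra), is also a finitary factor of an IID process. Here a process $Z=(Z_v)_{v\in\mathbb Z^d}$ is a *finitary factor of an IID process* if there are IID random variables $U=(U_v)_{v\in\mathbb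 Z^d}$ with values in a standard Borel space and a measurable map $F$ such that $Z$ has the same law as $F(U)$; $F(U+v)=F(U)+v$ almost surely for every $v\in\mathbb Z^d$, where $(U+v)_w=U_{w-v}$; and there is an almost surely finite stopping time $R$ with respect to the filtration $\mathcal F_n=\sigma(U_v:\|v\|_\infty\le n)$, $n\ge 0$, such that $F(U)_0$ is $\mathcal F_R$-measurable. -/

import Mathlib

open MeasureTheory ProbabilityTheory

/-- The lattice `ℤ^d`; its norm is the sup norm. -/
abbrev IntLattice (d : ℕ) : Type := Fin d → ℤ

/-- The finite non-empty subsets of `ℤ^d`. -/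
abbrev NonemptyFinset (d : ℕ) : Type := {A : Finset (IntLattice d) // A.Nonempty}

/-- The translate `A + v` of a finite non-empty subset of `ℤ^d`. -/
def NonemptyFinset.translate {d : ℕ} (A : NonemptyFinset d) (v : IntLattice d) : NonemptyFinset d :=
  ⟨A.1.map (addRightEmbedding v), A.2.map⟩

/-- The collection of finite subsets of `ℤ^d` that contain the origin. -/
abbrev OriginFinset (d : ℕ) : Type := {A : NonemptyFinset d // (0 : IntLattice d) ∈ A.1}

/-- The translation of configurations: `(U + v)_w = U_{w - v}`. -/
def shift {d : ℕ} {S : Type*} (v : IntLattice d) (U : IntLattice d → S) : IntLattice d → S :=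
  fun w => U (w - v)

/-- The filtration `ℱ_n = σ(U_v : ‖v‖ ≤ n)` on the space of configurations `U`. -/
def ballFiltration (d : ℕ) (S : Type*) [MeasurableSpace S] :
    Filtration ℕ (MeasurableSpace.pi : MeasurableSpace (IntLattice d → S)) where
  seq n := ⨆ (v : IntLattice d) (_ : ‖v‖ ≤ (n : ℝ)),
    MeasurableSpace.comap (fun U : IntLattice d → S => U v) inferInstance
  mono' _ _ hmn := iSup₂_mono' fun v hv => ⟨v, hv.trans (Nat.cast_le.mpr hmn), le_rfl⟩
  le' _ := iSup₂_le fun v _ => (measurable_pi_apply v).comap_le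

/-- The process `Z = (Z_v)_{v ∈ ℤ^d}` with values in `E` is a finitary factor of an IID process:
it has the same law as `F(U)`, where `U = (U_v)_{v ∈ ℤ^d}` is IID with values in a standard Borel
space and marginal law `μ`, the map `F` is measurable and almost surely translation equivariant,
and there is an almost surely finite stopping time `R` with respect to the filtration
`ℱ_n = σ(U_v : ‖v‖ ≤ n)` (a coding radius) such that `F(U)_0` is `ℱ_R`-measurable. -/
def IsFinitaryFactorOfIID {d : ℕ} {Ω E : Type*} [MeasurableSpace Ω] [MeasurableSpace E]
    (P : Measure Ω) (Z : IntLattice d → Ω → E) : Prop :=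
  ∃ (S : Type) (_ : MeasurableSpace S) (_ : StandardBorelSpace S)
    (μ : Measure S) (_ : IsProbabilityMeasure μ) (F : (IntLattice d → S) → (IntLattice d → E)),
    Measurable F ∧
    (∀ v : IntLattice d, ∀ᵐ U ∂(Measure.infinitePi fun _ : IntLattice d => μ),
      F (shift v U) = shift v (F U)) ∧
    IdentDistrib (fun ω v => Z v ω) F P (Measure.infinitePi fun _ : IntLattice d => μ) ∧
    ∃ (R : (IntLattice d → S) → WithTop ℕ) (hR : IsStoppingTime (ballFiltration d S) R),
      (∀ᵐ U ∂(Measure.infinitePi fun _ : IntLattice d => μ), R U ≠ ⊤) ∧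
      Measurable[hR.measurableSpace] (fun U => F U 0)

/-- The random set `X̄`, the union of all selected sets, `A` being selected when `X A = true`. -/
def unionSet {d : ℕ} {Ω : Type*} (X : NonemptyFinset d → Ω → Bool) (ω : Ω) : Set (IntLattice d) :=
  ⋃ (A : NonemptyFinset d) (_ : X A ω = true), (A.1 : Set (IntLattice d))

open Classical in
/-- The random set `X̄` as a `{0,1}`-valued process on `ℤ^d`. -/
noncomputable def unionProcess {d : ℕ} {Ω : Type*} (X : NonemptyFinset d → Ω → Bool)
    (v : IntLattice d) (ω : Ω) : Bool :=
  decide (v ∈ unionSet X ω)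

/-- The collection of those `A ∋ 0` for which the set `A + v` is selected. -/
def selectedSets {d : ℕ} {Ω : Type*} (X : NonemptyFinset d → Ω → Bool)
    (v : IntLattice d) (ω : Ω) : Set (OriginFinset d) :=
  {A | X (A.1.translate v) ω = true}

open Classical in
/-- The process `X̂`, with `X̂_v = {A ∋ 0 : A + v is selected}`. Its values are finite collections
of finite subsets of `ℤ^d` that contain the origin; the value is set to `∅` where the collection
is infinite. These collections are countably many and carry the discrete σ-algebra. -/
noncomputable def selectedProcess {d : ℕ} {Ω : Type*} (X : NonemptyFinset d → Ω → Bool)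
    (v : IntLattice d) (ω : Ω) : Finset (OriginFinset d) :=
  if h : (selectedSets X v ω).Finite then h.toFinset else ∅

/-! The sets are split into translation invariant levels, each with finitely many sets through the
origin (`exists_level`). Each set of level 0 is decided by one bit stored at its corner. Doing this
for all sets would in general require reading infinitely many remote bits, so on level `k + 1` the
sets are instead sampled by coupling from the past, as the stationary state of a dynamics in which
every site knows most of the time, from its own randomness, that no set passes through it.

In this dynamics each site is also on or off, and selected sets consist of sites that are on. With
`g = gap k` and odds `r`, a state has weight `∏ r A * g ^ #on * (1 + g⁻¹) ^ #covered`. A covered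
site thus contributes `1 + g`, just as an uncovered site does after summation over on and off, so
under these weights the selected sets are independent with the right odds (`sum_stateWeight_prod`).
An update at `w` is either a deletion, which switches `w` off and removes all sets through it, or a
proposal to switch `w` on while adding a collection of sets through `w` whose other sites are
already on. Each deletion of an on site reverses exactly one accepted collection, and the weights
are stationary (`sum_stateWeight_step`).

A deletion makes a site forget its past. Hence the state at a site can be found by a backward search
to its last deletion, which branches only at proposals of nonempty collections through the site.
Since the sets of the level are rare, this branching is subcritical: the search fails at depth `n`
with probability at most `(2 * g) ^ n` (`measure_not_determined_le`). A successful search is a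
finite certificate on which all runs agree (`Determined.agreeAt`); therefore the limit over windows
is equivariant and has the stationary law (`measure_limitSets`).

Infinitely many levels are handled by the on/off states: a site that is deleted in the last round
stays off until time 0, and no set can be added through it. This fails on level `k + 1` with
probability at most `2 * gap k`, which is summable. By Borel–Cantelli all but finitely many levels
are settled by the randomness at the origin alone, and the others by finite certificates
(`IsLevel.ae_isCertified`). Different levels use disjoint randomness, so the whole `coding` has the
law of `X`, and both processes are local functions of it. -/

/-! ### Translates of finite sets -/

section Translates

variable {d : ℕ}

@[simp]
lemma NonemptyFinset.mem_translate {A : NonemptyFinset d} {u v : IntLattice d} :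
    u ∈ (A.translate v).1 ↔ u - v ∈ A.1 := by
  simp only [NonemptyFinset.translate, Finset.mem_map, addRightEmbedding_apply]
  exact ⟨by rintro ⟨a, ha, rfl⟩; simpa using ha, fun h => ⟨u - v, h, by simp⟩⟩

lemma NonemptyFinset.ext_mem {A B : NonemptyFinset d} (h : ∀ u, u ∈ A.1 ↔ u ∈ B.1) : A = B :=
  Subtype.ext (Finset.ext h)

@[simp]
lemma NonemptyFinset.translate_translate (A : NonemptyFinset d) (u v : IntLattice d) :
    (A.translate u).translate v = A.translate (u + v) :=
  NonemptyFinset.ext_mem fun x => by simp [sub_sub, add_comm]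

@[simp]
lemma NonemptyFinset.translate_zero (A : NonemptyFinset d) : A.translate 0 = A :=
  NonemptyFinset.ext_mem fun x => by simp

lemma NonemptyFinset.translate_injective (v : IntLattice d) :
    Function.Injective fun A : NonemptyFinset d => A.translate v := fun A B h => by
  simpa using congrArg (fun C : NonemptyFinset d => C.translate (-v)) h

/-- The union of a finite collection of finite sets. -/
def hull (C : Finset (NonemptyFinset d)) : Finset (IntLattice d) := C.biUnion fun A => A.1

lemma mem_hull {C : Finset (NonemptyFinset d)} {u : IntLattice d} :
    u ∈ hull C ↔ ∃ A ∈ C, u ∈ A.1 := by simp [hull]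

/-- The translates by `v` of the members of a finite collection. -/
def translateAll (C : Finset (NonemptyFinset d)) (v : IntLattice d) : Finset (NonemptyFinset d) :=
  C.map ⟨fun A => A.translate v, NonemptyFinset.translate_injective v⟩

@[simp]
lemma mem_translateAll {C : Finset (NonemptyFinset d)} {v : IntLattice d} {A : NonemptyFinset d} :
    A ∈ translateAll C v ↔ A.translate (-v) ∈ C := by
  simp only [translateAll, Finset.mem_map, Function.Embedding.coeFn_mk]
  exact ⟨by rintro ⟨a, ha, rfl⟩; simpa using ha, fun h => ⟨_, h, by simp⟩⟩

lemma mem_hull_translateAll {C : Finset (NonemptyFinset d)} {u v : IntLattice d} :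
    u ∈ hull (translateAll C v) ↔ u - v ∈ hull C := by
  simp only [mem_hull, mem_translateAll]
  constructor
  · rintro ⟨A, hA, hu⟩; exact ⟨_, hA, by simpa using hu⟩
  · rintro ⟨A, hA, hu⟩; exact ⟨A.translate v, by simpa using hA, by simpa using hu⟩

lemma hull_union (C D : Finset (NonemptyFinset d)) : hull (C ∪ D) = hull C ∪ hull D :=
  Finset.union_biUnion ..

end Translates

/-! ### Events and marks -/

/-- Update events, ordered by time and then by the lexicographic order of the sites. -/
abbrev Ev (d : ℕ) : Type := ℤ ×ₗ Lex (Fin d → ℤ)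

namespace Ev

variable {d : ℕ}

/-- The event at time `j` and site `v`. -/
def mk (j : ℤ) (v : IntLattice d) : Ev d := toLex (j, toLex v)

/-- The time of an event. -/
def time (e : Ev d) : ℤ := (ofLex e).1

/-- The site of an event. -/
def site (e : Ev d) : IntLattice d := ofLex (ofLex e).2

@[simp] lemma time_mk (j : ℤ) (v : IntLattice d) : (mk j v).time = j := rfl
@[simp] lemma site_mk (j : ℤ) (v : IntLattice d) : (mk j v).site = v := rfl
@[simp] lemma mk_eta (e : Ev d) : mk e.time e.site = e := rfl

lemma mk_injective {j k : ℤ} {v w : IntLattice d} (h : mk j v = mk k w) : j = k ∧ v = w :=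
  ⟨congrArg time h, congrArg site h⟩

lemma lt_iff {e f : Ev d} :
    e < f ↔ e.time < f.time ∨ e.time = f.time ∧ toLex e.site < toLex f.site :=
  Prod.Lex.toLex_lt_toLex

lemma lt_of_time_lt {e f : Ev d} (h : e.time < f.time) : e < f := lt_iff.2 (Or.inl h)

lemma time_le_of_le {e f : Ev d} (h : e ≤ f) : e.time ≤ f.time := by
  rcases h.lt_or_eq with h | h
  · rcases lt_iff.1 h with h | h
    · exact h.le
    · exact h.1.le
  · exact h ▸ le_rfl

/-- The translate of an event. -/
def shift (v : IntLattice d) (e : Ev d) : Ev d := mk e.time (e.site + v)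

@[simp] lemma time_shift (v : IntLattice d) (e : Ev d) : (shift v e).time = e.time := rfl
@[simp] lemma site_shift (v : IntLattice d) (e : Ev d) : (shift v e).site = e.site + v := rfl

/-- The lexicographic order of the sites is used because it is translation invariant; an arbitrary
enumeration would destroy the equivariance of the dynamics. -/
lemma shift_lt_shift {v : IntLattice d} {e f : Ev d} : shift v e < shift v f ↔ e < f := by
  simp only [lt_iff, time_shift, site_shift, toLex_add, add_lt_add_iff_right]

instance : Countable (Ev d) :=
  Function.Injective.countable (f := fun e : Ev d => (e.time, e.site)) fun e f h => by
    rw [← mk_eta e, ← mk_eta f]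
    rw [Prod.mk.injEq] at h
    rw [h.1, h.2]

end Ev

/-- The marks of update events: no update, deletion of all selected sets through the site,
or a proposal to select the translates of the sets in `C`, subject to `E` being uncovered. -/
inductive Mark (d : ℕ) : Type
  | noop : Mark d
  | kill : Mark d
  | birth (C : Finset (NonemptyFinset d)) (E : Finset (IntLattice d)) : Mark d

instance (d : ℕ) : Countable (Mark d) :=
  Function.Injective.countable (β := Option (Option (Finset (NonemptyFinset d) ×
      Finset (IntLattice d))))
    (f := fun m => match m with
      | .noop => none
      | .kill => some none
      | .birth C E => some (some (C, E))) fun m n h => by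
    cases m <;> cases n <;> simp_all

instance (d : ℕ) : MeasurableSpace (Mark d) := ⊤

instance (d : ℕ) : DiscreteMeasurableSpace (Mark d) := ⟨fun _ => trivial⟩

/-! ### The dynamics -/

section Dynamics

variable {d : ℕ}

/-- The state of the dynamics: the selected sets and the sites that are switched on. -/
abbrev DynState (d : ℕ) : Type := Finset (NonemptyFinset d) × Finset (IntLattice d)

/-- The condition under which a proposal is accepted. -/
def Accepts (T : Finset (NonemptyFinset d)) (w : IntLattice d) (C : Finset (NonemptyFinset d))
    (E : Finset (IntLattice d)) (s : DynState d) : Prop :=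
  C ⊆ T ∧ E ⊆ hull C ∧ w ∉ s.2 ∧ (∀ y ∈ hull C, y ≠ 0 → y + w ∈ s.2) ∧ ∀ y ∈ E, y + w ∉ hull s.1

/-- The state after the selection of the translates of the members of `C`. -/
def addSets (w : IntLattice d) (C : Finset (NonemptyFinset d)) (s : DynState d) : DynState d :=
  (s.1 ∪ translateAll C w, insert w s.2)

/-- The state after the removal of all sets through `w`. -/
def removeSets (w : IntLattice d) (s : DynState d) : DynState d :=
  ({A ∈ s.1 | w ∉ A.1}, s.2.erase w)

open Classical in
/-- The update at the site `w`. -/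
noncomputable def step (T : Finset (NonemptyFinset d)) (w : IntLattice d) :
    Mark d → DynState d → DynState d
  | .noop, s => s
  | .kill, s => removeSets w s
  | .birth C E, s => if Accepts T w C E s then addSets w C s else s

/-- The state after the events in `W`. -/
noncomputable def run (T : Finset (NonemptyFinset d)) (W : Finset (Ev d)) (M : Ev d → Mark d)
    (s : DynState d) : DynState d :=
  (W.sort (· ≥ ·)).foldr (fun e => step T e.site (M e)) s

variable {T : Finset (NonemptyFinset d)}

@[simp]
lemma run_empty (M : Ev d → Mark d) (s : DynState d) : run T ∅ M s = s := by simp [run]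

/-- The sort is descending and `foldr` starts at the end of the list, so the earliest event acts
first and the maximal one last. -/
lemma run_insert {W : Finset (Ev d)} {a : Ev d} (ha : ∀ b ∈ W, b < a) (M : Ev d → Mark d)
    (s : DynState d) : run T (insert a W) M s = step T a.site (M a) (run T W M s) := by
  rw [run, Finset.sort_insert _ (fun b hb => (ha b hb).le) (fun h => (ha a h).false)]
  rfl

lemma run_congr {W : Finset (Ev d)} {M M' : Ev d → Mark d} (h : ∀ e ∈ W, M e = M' e)
    (s : DynState d) : run T W M s = run T W M' s := by
  induction W using Finset.induction_on_max with
  | empty => simp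
  | insert a W ha ih =>
    rw [run_insert ha, run_insert ha, h a (Finset.mem_insert_self ..),
      ih fun e he => h e (Finset.mem_insert_of_mem he)]

lemma run_filter {W : Finset (Ev d)} {M : Ev d → Mark d} {p : Ev d → Prop} [DecidablePred p]
    (h : ∀ e ∈ W, ¬ p e → M e = .noop) (s : DynState d) :
    run T (W.filter p) M s = run T W M s := by
  induction W using Finset.induction_on_max with
  | empty => simp
  | insert a W ha ih =>
    specialize ih fun e he => h e (Finset.mem_insert_of_mem he)
    rw [run_insert ha, Finset.filter_insert]
    split_ifs with hp
    · rw [run_insert (fun b hb => ha b (Finset.mem_filter.1 hb).1), ih]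
    · rw [ih, h a (Finset.mem_insert_self ..) hp, step]

lemma run_mono_of_noop {W W' : Finset (Ev d)} {M : Ev d → Mark d} (hW : W ⊆ W')
    (h : ∀ e ∈ W', e ∉ W → M e = .noop) (s : DynState d) : run T W' M s = run T W M s := by
  rw [← run_filter (p := fun e => e ∈ W) h]
  congr 1
  ext e
  simpa using fun he => hW he

/-- The configuration of marks, restricted to a finite set of events. -/
def restrictTo (W : Finset (Ev d)) (M : Ev d → Mark d) (e : Ev d) : Mark d :=
  if e ∈ W then M e else .noop

/-- Padding with `noop` makes runs over different windows comparable over a common window. -/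
lemma run_restrictTo {W W' : Finset (Ev d)} (hW : W ⊆ W') (M : Ev d → Mark d) (s : DynState d) :
    run T W' (restrictTo W M) s = run T W M s := by
  rw [run_mono_of_noop hW (M := restrictTo W M) (fun e _ he => if_neg he)]
  exact run_congr (fun e he => if_pos he) s

/-- All sets in `s` are translates of members of `T`. -/
def InClass (T : Finset (NonemptyFinset d)) (s : DynState d) : Prop :=
  ∀ A ∈ s.1, ∀ u ∈ A.1, A.translate (-u) ∈ T

lemma InClass.empty : InClass T (∅, ∅) := fun A hA => by simp at hA

/-- This invariant gives deletions a finite range: removing a set through `w` can affect `u` only if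
`u - w` lies in a member of `T`. -/
lemma InClass.step (hT : ∀ A ∈ T, ∀ u ∈ A.1, A.translate (-u) ∈ T) {s : DynState d}
    (hs : InClass T s) (w : IntLattice d) (m : Mark d) : InClass T (step T w m s) := by
  cases m with
  | noop => exact hs
  | kill => exact fun A hA => hs A (Finset.mem_filter.1 hA).1
  | birth C E =>
    rw [_root_.step]
    split_ifs with h
    · intro A hA u hu
      rcases Finset.mem_union.1 hA with hA | hA
      · exact hs A hA u hu
      · rw [mem_translateAll] at hA
        have := hT _ (h.1 hA) (u - w) (by simpa using hu)
        rwa [NonemptyFinset.translate_translate, show -w + -(u - w) = -u by abel] at this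
    · exact hs

lemma InClass.run (hT : ∀ A ∈ T, ∀ u ∈ A.1, A.translate (-u) ∈ T) {s : DynState d}
    (hs : InClass T s) (W : Finset (Ev d)) (M : Ev d → Mark d) : InClass T (run T W M s) := by
  induction W using Finset.induction_on_max with
  | empty => simpa
  | insert a W ha ih => rw [run_insert ha]; exact ih.step hT _ _

/-! ### Certificates for the value at a site -/

/-- `Determined T M n u e`: the marks in `M` that are not `noop` determine, in a search of depth at
most `n`, the state at the site `u` before the event `e`. -/
def Determined (T : Finset (NonemptyFinset d)) (M : Ev d → Mark d) :
    ℕ → IntLattice d → Ev d → Prop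
  | 0, _, _ => False
  | n + 1, u, e => ∃ k : ℤ, Ev.mk k u < e ∧ M (Ev.mk k u) = .kill ∧
      ∀ f : Ev d, Ev.mk k u < f → f < e → f.time < 0 → u - f.site ∈ insert 0 (hull T) →
        M f ≠ .noop ∧ ∀ C E, M f = .birth C E → C ⊆ T → E ⊆ hull C → u - f.site ∈ hull C →
          ∀ y ∈ hull C, y + f.site ≠ u → Determined T M n (y + f.site) f

/-- The states `s` and `t` agree at the site `u`. -/
def AgreeAt (u : IntLattice d) (s t : DynState d) : Prop :=
  (u ∈ s.2 ↔ u ∈ t.2) ∧ ∀ A : NonemptyFinset d, u ∈ A.1 → (A ∈ s.1 ↔ A ∈ t.1)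

lemma AgreeAt.mem_hull {u : IntLattice d} {s t : DynState d} (h : AgreeAt u s t) :
    u ∈ hull s.1 ↔ u ∈ hull t.1 := by
  simp only [_root_.mem_hull]
  exact ⟨fun ⟨A, hA, hu⟩ => ⟨A, (h.2 A hu).1 hA, hu⟩, fun ⟨A, hA, hu⟩ => ⟨A, (h.2 A hu).2 hA, hu⟩⟩

lemma AgreeAt.trans {u : IntLattice d} {s t r : DynState d} (h : AgreeAt u s t)
    (h' : AgreeAt u t r) : AgreeAt u s r :=
  ⟨h.1.trans h'.1, fun A hA => (h.2 A hA).trans (h'.2 A hA)⟩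

lemma AgreeAt.symm {u : IntLattice d} {s t : DynState d} (h : AgreeAt u s t) : AgreeAt u t s :=
  ⟨h.1.symm, fun A hA => (h.2 A hA).symm⟩

/-- The regeneration behind the coupling: nothing is assumed about `s` and `t`. -/
lemma agreeAt_kill (u : IntLattice d) (s t : DynState d) :
    AgreeAt u (step T u .kill s) (step T u .kill t) := by
  constructor
  · simp [step, removeSets]
  · intro A hA
    simp [step, removeSets, hA]

lemma AgreeAt.kill {u : IntLattice d} {s t : DynState d} (h : AgreeAt u s t) (w : IntLattice d) :
    AgreeAt u (step T w .kill s) (step T w .kill t) := by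
  constructor
  · simp [step, removeSets, h.1]
  · intro A hA
    simp [step, removeSets, h.2 A hA]

/-- A birth that does not involve `u` does not change the state at `u`. -/
lemma agreeAt_birth_of_notMem {u w : IntLattice d} {C : Finset (NonemptyFinset d)}
    {E : Finset (IntLattice d)} (huw : u ≠ w) (hu : u - w ∉ hull C) (s : DynState d) :
    AgreeAt u (step T w (.birth C E) s) s := by
  rw [step]
  split_ifs with h
  · refine ⟨by simp [addSets, huw], fun A hA => ?_⟩
    simp only [addSets, Finset.mem_union, mem_translateAll, or_iff_left_iff_imp]
    intro h'
    exact absurd (_root_.mem_hull.2 ⟨_, h', by simpa using hA⟩) hu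
  · exact ⟨Iff.rfl, fun _ _ => Iff.rfl⟩

/-- Acceptance inspects only `w` and the translated hull of `C`. A proposal with `C ⊈ T` or `E ⊈
hull C` is rejected in both states, so agreement is required only for the others. -/
lemma AgreeAt.birth {u w : IntLattice d} {C : Finset (NonemptyFinset d)}
    {E : Finset (IntLattice d)} {s t : DynState d} (h : AgreeAt u s t) (hw : AgreeAt w s t)
    (hC : C ⊆ T → E ⊆ hull C → ∀ y ∈ hull C, AgreeAt (y + w) s t) :
    AgreeAt u (step T w (.birth C E) s) (step T w (.birth C E) t) := by
  have key : Accepts T w C E s ↔ Accepts T w C E t := by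
    unfold Accepts
    refine and_congr_right fun h1 => and_congr_right fun h2 => and_congr (not_congr hw.1)
      (and_congr ?_ ?_)
    · exact forall₂_congr fun y hy => imp_congr_right fun _ => (hC h1 h2 y hy).1
    · exact forall₂_congr fun y hy => not_congr (hC h1 h2 y (h2 hy)).mem_hull
  rw [step, step]
  by_cases hs : Accepts T w C E s
  · rw [if_pos hs, if_pos (key.1 hs)]
    exact ⟨by simp [addSets, h.1], fun A hA => by simp [addSets, h.2 A hA]⟩
  · rw [if_neg hs, if_neg (key.not.1 hs)]
    exact h

/-- An update at a site out of range does not change the state at `u`. -/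
lemma agreeAt_step_of_far {u w : IntLattice d} {s : DynState d} (hs : InClass T s)
    (hw : u - w ∉ insert 0 (hull T)) (m : Mark d) : AgreeAt u (step T w m s) s := by
  have huw : u ≠ w := by rintro rfl; simp at hw
  have hh : u - w ∉ hull T := fun h => hw (Finset.mem_insert_of_mem h)
  cases m with
  | noop => exact ⟨Iff.rfl, fun _ _ => Iff.rfl⟩
  | kill =>
    refine ⟨by simp [step, removeSets, huw], fun A hA => ?_⟩
    simp only [step, removeSets, Finset.mem_filter, and_iff_left_iff_imp]
    intro h hwA
    exact hh (_root_.mem_hull.2 ⟨_, hs A h w hwA, by simpa using hA⟩)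
  | birth C E =>
    by_cases hC : u - w ∈ hull C
    · have : ¬ Accepts T w C E s := fun h => by
        obtain ⟨A, hA, hu⟩ := _root_.mem_hull.1 hC
        exact hh (_root_.mem_hull.2 ⟨A, h.1 hA, hu⟩)
      rw [step, if_neg this]
      exact ⟨Iff.rfl, fun _ _ => Iff.rfl⟩
    · exact agreeAt_birth_of_notMem huw hC s

/-- Two runs that both extend a certificate agree at the certified site. -/
theorem Determined.agreeAt (hT0 : ∀ A ∈ T, 0 ∈ A.1)
    (hT : ∀ A ∈ T, ∀ u ∈ A.1, A.translate (-u) ∈ T) {M M₁ M₂ : Ev d → Mark d}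
    (h₁ : ∀ e, M e ≠ .noop → M₁ e = M e) (h₂ : ∀ e, M e ≠ .noop → M₂ e = M e)
    (n₁ : ∀ e : Ev d, 0 ≤ e.time → M₁ e = .noop) (n₂ : ∀ e : Ev d, 0 ≤ e.time → M₂ e = .noop)
    {W : Finset (Ev d)} (hW : ∀ e, M e ≠ .noop → e ∈ W) {s₁ s₂ : DynState d}
    (hs₁ : InClass T s₁) (hs₂ : InClass T s₂) {n : ℕ} {u : IntLattice d} {e : Ev d}
    (h : Determined T M n u e) :
    AgreeAt u (run T {f ∈ W | f < e} M₁ s₁) (run T {f ∈ W | f < e} M₂ s₂) := by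
  induction n generalizing u e with
  | zero => exact h.elim
  | succ n ih =>
    obtain ⟨k, hk, hkill, h⟩ := h
    have hkW : Ev.mk k u ∈ W := hW _ (by simp [hkill])
    -- Inner induction on the initial segments of events that contain the deletion at `u`: the
    -- deletion creates the agreement, and later events have to preserve it.
    suffices H : ∀ S : Finset (Ev d), (∀ b ∈ W, ∀ c ∈ S, b ≤ c → b ∈ S) → S ⊆ {f ∈ W | f < e} →
        Ev.mk k u ∈ S → AgreeAt u (run T S M₁ s₁) (run T S M₂ s₂) by
      refine H _ (fun b hb c hc hbc => ?_) subset_rfl ?_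
      · exact Finset.mem_filter.2 ⟨hb, hbc.trans_lt (Finset.mem_filter.1 hc).2⟩
      · exact Finset.mem_filter.2 ⟨hkW, hk⟩
    intro S
    induction S using Finset.induction_on_max with
    | empty => intro _ _ h; simp at h
    | insert a S ha ihS =>
      intro hinit hsub hmem
      have haW := Finset.mem_filter.1 (hsub (Finset.mem_insert_self a S))
      have hS : S = {f ∈ W | f < a} := by
        ext f
        rw [Finset.mem_filter]
        refine ⟨fun hf => ⟨(Finset.mem_filter.1 (hsub (Finset.mem_insert_of_mem hf))).1, ha f hf⟩,
          fun hf => ?_⟩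
        have := hinit f hf.1 a (Finset.mem_insert_self ..) hf.2.le
        exact (Finset.mem_insert.1 this).resolve_left hf.2.ne
      rw [run_insert ha, run_insert ha]
      rcases Finset.mem_insert.1 hmem with hka | hkS
      · rw [← hka, h₁ _ (by simp [hkill]), h₂ _ (by simp [hkill]), hkill]
        exact agreeAt_kill u _ _
      · have ihu := ihS (fun b hb c hc hbc => by
          have := hinit b hb c (Finset.mem_insert_of_mem hc) hbc
          exact (Finset.mem_insert.1 this).resolve_left (hbc.trans_lt (ha c hc)).ne)
          (fun f hf => hsub (Finset.mem_insert_of_mem hf)) hkS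
        have c₁ := hs₁.run hT S M₁
        have c₂ := hs₂.run hT S M₂
        rcases le_or_gt 0 a.time with ht | ht
        · rw [n₁ a ht, n₂ a ht]; exact ihu
        -- Within range the mark is known and common to both runs. Out of range the marks may
        -- differ, but they do not touch `u`.
        by_cases hnear : u - a.site ∈ insert 0 (hull T)
        · obtain ⟨hne, hb⟩ := h a (ha _ hkS) haW.2 ht hnear
          rw [h₁ a hne, h₂ a hne]
          match hMa : M a with
          | .noop => exact absurd hMa hne
          | .kill => exact ihu.kill _
          | .birth C E =>
            by_cases hC : C ⊆ T ∧ E ⊆ hull C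
            swap
            · have : ∀ s, ¬ Accepts T a.site C E s := fun s hs => hC ⟨hs.1, hs.2.1⟩
              rw [step, step, if_neg (this _), if_neg (this _)]
              exact ihu
            by_cases hu : u - a.site ∈ hull C
            · have hall : ∀ y ∈ hull C, AgreeAt (y + a.site) (run T S M₁ s₁) (run T S M₂ s₂) := by
                intro y hy
                by_cases hyu : y + a.site = u
                · rw [hyu]; exact ihu
                · have := ih (hb C E hMa hC.1 hC.2 hu y hy hyu)
                  rwa [← hS] at this
              refine ihu.birth ?_ fun _ _ => hall
              obtain ⟨A, hA, -⟩ := _root_.mem_hull.1 hu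
              simpa using hall 0 (_root_.mem_hull.2 ⟨A, hA, hT0 A (hC.1 hA)⟩)
            · by_cases hua : u = a.site
              · by_cases hCe : C = ∅
                · subst hCe
                  refine ihu.birth (hua ▸ ihu) fun _ _ y hy => ?_
                  simp [hull] at hy
                · obtain ⟨A, hA⟩ := Finset.nonempty_iff_ne_empty.2 hCe
                  refine absurd (_root_.mem_hull.2 ⟨A, hA, ?_⟩) hu
                  rw [hua, sub_self]
                  exact hT0 A (hC.1 hA)
              · exact (agreeAt_birth_of_notMem hua hu _).trans
                  (ihu.trans (agreeAt_birth_of_notMem hua hu _).symm)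
        · exact (agreeAt_step_of_far c₁ hnear _).trans
            (ihu.trans (agreeAt_step_of_far c₂ hnear _).symm)

end Dynamics

/-! ### Finite windows and the stationary configuration -/

section Windows

variable {d : ℕ}

/-- The events before time `0` in a finite window. -/
noncomputable def win (d n : ℕ) : Finset (Ev d) :=
  (Finset.Ico (-(n : ℤ)) 0 ×ˢ Finset.Icc (fun _ : Fin d => -(n : ℤ)) fun _ => (n : ℤ)).map
    ⟨fun q => Ev.mk q.1 q.2, fun _ _ h => Prod.ext (Ev.mk_injective h).1 (Ev.mk_injective h).2⟩

lemma norm_le_iff {v : IntLattice d} {n : ℕ} :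
    ‖v‖ ≤ (n : ℝ) ↔ v ∈ Finset.Icc (fun _ : Fin d => -(n : ℤ)) fun _ => (n : ℤ) := by
  rw [pi_norm_le_iff_of_nonneg n.cast_nonneg, Finset.mem_Icc, Pi.le_def, Pi.le_def, ← forall_and]
  refine forall_congr' fun i => ?_
  rw [Int.norm_eq_abs, ← Int.cast_abs, ← abs_le]
  exact_mod_cast Iff.rfl

lemma mem_win {n : ℕ} {e : Ev d} :
    e ∈ win d n ↔ (-(n : ℤ) ≤ e.time ∧ e.time < 0) ∧ ‖e.site‖ ≤ (n : ℝ) := by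
  rw [norm_le_iff]
  simp only [win, Finset.mem_map, Finset.mem_product, Finset.mem_Ico]
  constructor
  · rintro ⟨q, ⟨h, h'⟩, rfl⟩; exact ⟨h, h'⟩
  · rintro ⟨h, h'⟩; exact ⟨(e.time, e.site), ⟨h, h'⟩, rfl⟩

lemma win_mono {m n : ℕ} (h : m ≤ n) : win d m ⊆ win d n := fun e he => by
  rw [mem_win] at he ⊢
  have : (m : ℝ) ≤ n := by exact_mod_cast h
  exact ⟨⟨by omega, he.1.2⟩, he.2.trans this⟩

lemma eventually_mem_win {e : Ev d} (he : e.time < 0) : ∀ᶠ n in Filter.atTop, e ∈ win d n := by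
  obtain ⟨N, hN⟩ := exists_nat_ge ‖e.site‖
  filter_upwards [Filter.eventually_ge_atTop (max N e.time.natAbs)] with n hn
  rw [mem_win]
  have : (N : ℝ) ≤ n := by exact_mod_cast (le_max_left _ _).trans hn
  have := (le_max_right N e.time.natAbs).trans hn
  exact ⟨⟨by omega, he⟩, by linarith⟩

lemma eventually_subset_win (W : Finset (Ev d)) (hW : ∀ e ∈ W, e.time < 0) :
    ∀ᶠ n in Filter.atTop, W ⊆ win d n :=
  (Filter.eventually_all_finset W).2 fun e he => eventually_mem_win (hW e he)

/-- The position of the origin of time, after all updates. -/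
def Ev.final (d : ℕ) : Ev d := Ev.mk 0 0

variable {T : Finset (NonemptyFinset d)}

/-- The sets that are selected at time `0` in all sufficiently large windows. -/
def limitSets (T : Finset (NonemptyFinset d)) (M : Ev d → Mark d) : Set (NonemptyFinset d) :=
  {A | ∃ n₀, ∀ n, n₀ ≤ n → A ∈ (run T (win d n) M (∅, ∅)).1}

/-- `M'` has all marks of `M`. -/
def Extends (M' M : Ev d → Mark d) : Prop := ∀ e, M e ≠ .noop → M' e = M e

lemma extends_restrictTo (W : Finset (Ev d)) (M : Ev d → Mark d) :
    Extends M (restrictTo W M) := fun e he => by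
  unfold restrictTo at he ⊢
  split_ifs at he ⊢ <;> simp_all

lemma restrictTo_extends {W W' : Finset (Ev d)} (h : W ⊆ W') (M : Ev d → Mark d) :
    Extends (restrictTo W' M) (restrictTo W M) := fun e he => by
  unfold restrictTo at he ⊢
  by_cases heW : e ∈ W
  · simp [heW, h heW]
  · simp [heW] at he

lemma Determined.mono {M M' : Ev d → Mark d} (hM : Extends M' M) {n m : ℕ} (hnm : n ≤ m)
    {u : IntLattice d} {e : Ev d} (h : Determined T M n u e) : Determined T M' m u e := by
  induction n generalizing u e m with
  | zero => exact h.elim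
  | succ n ih =>
    obtain ⟨m, rfl⟩ : ∃ m', m = m' + 1 := ⟨m - 1, by omega⟩
    obtain ⟨k, hk, hkill, h⟩ := h
    refine ⟨k, hk, by rw [hM _ (by simp [hkill]), hkill], fun f h1 h2 h3 h4 => ?_⟩
    obtain ⟨hne, h⟩ := h f h1 h2 h3 h4
    rw [hM f hne]
    exact ⟨hne, fun C E hC h5 h6 h7 y hy hyu => ih (by omega) (h C E hC h5 h6 h7 y hy hyu)⟩

/-- A successful search reads finitely many marks: at each stage, those between the deletion and `e`
at sites within range. -/
lemma Determined.eventually_restrictTo {M : Ev d → Mark d}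
    (hM : ∀ e : Ev d, 0 ≤ e.time → M e = .noop) {n : ℕ}
    {u : IntLattice d} {e : Ev d} (h : Determined T M n u e) :
    ∀ᶠ m in Filter.atTop, Determined T (restrictTo (win d m) M) n u e := by
  induction n generalizing u e with
  | zero => exact h.elim
  | succ n ih =>
    obtain ⟨k, hk, hkill, h⟩ := h
    have hk0 : k < 0 := by
      by_contra hk0
      have := hM (Ev.mk k u) (by simpa using hk0)
      simp [hkill] at this
    have hfin : {f : Ev d | Ev.mk k u < f ∧ f < e ∧ f.time < 0 ∧
        u - f.site ∈ insert 0 (hull T)}.Finite := by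
      refine Set.Finite.subset (((Finset.Ico k 0 ×ˢ insert 0 (hull T)).image
        fun q => Ev.mk q.1 (u - q.2)).finite_toSet) fun f hf => ?_
      simp only [Finset.coe_image, Set.mem_image, Finset.mem_coe, Finset.mem_product,
        Finset.mem_Ico]
      have := Ev.time_le_of_le hf.1.le
      exact ⟨(f.time, u - f.site), ⟨⟨this, hf.2.2.1⟩, hf.2.2.2⟩, by simp⟩
    have hev : ∀ f ∈ {f : Ev d | Ev.mk k u < f ∧ f < e ∧ f.time < 0 ∧
        u - f.site ∈ insert 0 (hull T)}, ∀ᶠ m in Filter.atTop,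
        f ∈ win d m ∧ ∀ C E, M f = .birth C E → C ⊆ T → E ⊆ hull C → u - f.site ∈ hull C →
          ∀ y ∈ hull C, y + f.site ≠ u →
            Determined T (restrictTo (win d m) M) n (y + f.site) f := by
      intro f hf
      obtain ⟨hne, h⟩ := h f hf.1 hf.2.1 hf.2.2.1 hf.2.2.2
      refine (eventually_mem_win hf.2.2.1).and ?_
      match hMf : M f with
      | .noop => exact absurd hMf hne
      | .kill => simp
      | .birth C E =>
        by_cases hc : C ⊆ T ∧ E ⊆ hull C ∧ u - f.site ∈ hull C
        · have : ∀ y ∈ hull C, ∀ᶠ m in Filter.atTop, y + f.site ≠ u →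
              Determined T (restrictTo (win d m) M) n (y + f.site) f := fun y hy => by
            by_cases hyu : y + f.site = u
            · simp [hyu]
            · filter_upwards [ih (h C E hMf hc.1 hc.2.1 hc.2.2 y hy hyu)] with m hm _ using hm
          filter_upwards [(Filter.eventually_all_finset _).2 this] with m hm C' E' hCE
          cases hCE
          exact fun _ _ _ => hm
        · refine Filter.Eventually.of_forall fun m C' E' hCE => ?_
          cases hCE
          exact fun h1 h2 h3 => absurd ⟨h1, h2, h3⟩ hc
    filter_upwards [(Filter.eventually_all_finite hfin).2 hev,
      eventually_mem_win (e := Ev.mk k u) hk0] with m hm hkm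
    refine ⟨k, hk, by rw [restrictTo, if_pos hkm, hkill], fun f h1 h2 h3 h4 => ?_⟩
    obtain ⟨hfm, hm⟩ := hm f ⟨h1, h2, h3, h4⟩
    rw [restrictTo, if_pos hfm]
    exact ⟨(h f h1 h2 h3 h4).1, hm⟩

variable (hT0 : ∀ A ∈ T, 0 ∈ A.1) (hT : ∀ A ∈ T, ∀ u ∈ A.1, A.translate (-u) ∈ T)

include hT0 hT in
-- Both runs are moved to the window `W₁ ∪ W₂`, with `noop` as the mark outside the original window;
-- the certificate survives because it lies in both windows.
lemma Determined.agreeAt_run {M M₁ M₂ : Ev d → Mark d} {n : ℕ}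
    (h₁ : Extends M₁ (restrictTo (win d n) M)) (h₂ : Extends M₂ (restrictTo (win d n) M))
    (n₁ : ∀ e : Ev d, 0 ≤ e.time → M₁ e = .noop) (n₂ : ∀ e : Ev d, 0 ≤ e.time → M₂ e = .noop)
    {W₁ W₂ : Finset (Ev d)} (hW₁ : win d n ⊆ W₁) (hW₂ : win d n ⊆ W₂) {s₁ s₂ : DynState d}
    (hs₁ : InClass T s₁) (hs₂ : InClass T s₂) {l : ℕ} {u : IntLattice d}
    (h : Determined T (restrictTo (win d n) M) l u (Ev.final d)) :
    AgreeAt u (run T W₁ M₁ s₁) (run T W₂ M₂ s₂) := by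
  have ext' : ∀ {W : Finset (Ev d)} {M' : Ev d → Mark d}, win d n ⊆ W →
      Extends M' (restrictTo (win d n) M) → Extends (restrictTo W M') (restrictTo (win d n) M) := by
    intro W M' hW h e he
    have : e ∈ win d n := by
      by_contra hne
      simp [restrictTo, hne] at he
    rw [restrictTo, if_pos (hW this), h e he]
  have noop' : ∀ {W : Finset (Ev d)} {M' : Ev d → Mark d},
      (∀ e : Ev d, 0 ≤ e.time → M' e = .noop) → ∀ e : Ev d, 0 ≤ e.time →
        restrictTo W M' e = .noop := by
    intro W M' h e he
    rw [restrictTo, h e he, ite_self]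
  have filt : ∀ {W : Finset (Ev d)} {M' : Ev d → Mark d} (s : DynState d),
      (∀ e : Ev d, 0 ≤ e.time → M' e = .noop) →
        run T {f ∈ W | f < Ev.final d} M' s = run T W M' s := by
    intro W M' s h
    exact run_filter (fun e _ he => h e (Ev.time_le_of_le (e := Ev.final d) (not_lt.1 he))) s
  have key := h.agreeAt (W := W₁ ∪ W₂) hT0 hT (ext' hW₁ h₁) (ext' hW₂ h₂) (noop' n₁) (noop' n₂)
    (fun e he => ?_) hs₁ hs₂
  · rwa [filt _ (noop' n₁), filt _ (noop' n₂), run_restrictTo Finset.subset_union_left,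
      run_restrictTo Finset.subset_union_right] at key
  · refine Finset.mem_union_left _ (hW₁ ?_)
    by_contra hne
    simp [restrictTo, hne] at he

include hT0 hT in
/-- On a certificate, the limit is attained in all runs that extend the certificate. -/
lemma Determined.mem_limitSets_iff {M M' : Ev d → Mark d} {n : ℕ}
    (n₀ : ∀ e : Ev d, 0 ≤ e.time → M e = .noop) (h' : Extends M' (restrictTo (win d n) M))
    (n' : ∀ e : Ev d, 0 ≤ e.time → M' e = .noop) {W : Finset (Ev d)} (hW : win d n ⊆ W)
    {s : DynState d} (hs : InClass T s) {l : ℕ} {u : IntLattice d}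
    (h : Determined T (restrictTo (win d n) M) l u (Ev.final d)) {A : NonemptyFinset d}
    (hA : u ∈ A.1) : A ∈ (run T W M' s).1 ↔ A ∈ limitSets T M := by
  have key : ∀ m, n ≤ m → (A ∈ (run T W M' s).1 ↔ A ∈ (run T (win d m) M (∅, ∅)).1) :=
    fun m hm => (h.agreeAt_run hT0 hT h' (extends_restrictTo _ _) n' n₀ hW (win_mono hm)
      hs InClass.empty).2 A hA
  constructor
  · exact fun hr => ⟨n, fun m hm => (key m hm).1 hr⟩
  · rintro ⟨m, hm⟩
    exact (key (max n m) (le_max_left ..)).2 (hm _ (le_max_right ..))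

include hT0 hT in
lemma Determined.mem_limitSets_congr {M M' : Ev d → Mark d} {n : ℕ}
    (n₀ : ∀ e : Ev d, 0 ≤ e.time → M e = .noop) (h' : Extends M' (restrictTo (win d n) M))
    (n' : ∀ e : Ev d, 0 ≤ e.time → M' e = .noop) {l : ℕ} {u : IntLattice d}
    (h : Determined T (restrictTo (win d n) M) l u (Ev.final d)) {A : NonemptyFinset d}
    (hA : u ∈ A.1) : A ∈ limitSets T M' ↔ A ∈ limitSets T M := by
  have key : ∀ m, n ≤ m → (A ∈ (run T (win d m) M' (∅, ∅)).1 ↔ A ∈ limitSets T M) :=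
    fun m hm => h.mem_limitSets_iff hT0 hT n₀ h' n' (win_mono hm) InClass.empty hA
  constructor
  · rintro ⟨m, hm⟩
    exact (key (max n m) (le_max_left ..)).1 (hm _ (le_max_right ..))
  · exact fun hr => ⟨n, fun m hm => (key m hm).2 hr⟩

/-- A deletion at `u` in the last round leaves no set through `u`. -/
lemma notMem_run_of_kill {u : IntLattice d} {M : Ev d → Mark d}
    (hM : ∀ e : Ev d, 0 ≤ e.time → M e = .noop) (hu : M (Ev.mk (-1) u) = .kill)
    (s : DynState d) {W : Finset (Ev d)} (hW : Ev.mk (-1) u ∈ W) :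
    u ∉ (run T W M s).2 ∧ ∀ A : NonemptyFinset d, u ∈ A.1 → A ∉ (run T W M s).1 := by
  induction W using Finset.induction_on_max with
  | empty => simp at hW
  | insert a W ha ih =>
    rw [run_insert ha]
    rcases Finset.mem_insert.1 hW with h | h
    · rw [← h, hu]
      exact ⟨by simp [step, removeSets], fun A hA h => (Finset.mem_filter.1 h).2 hA⟩
    · obtain ⟨ih1, ih2⟩ := ih h
      have hlt := ha _ h
      rcases le_or_gt 0 a.time with ht | ht
      · rw [hM a ht]; exact ⟨ih1, ih2⟩
      -- Each site is updated once per round, so `u` has no further update before time 0.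
      have hau : u ≠ a.site := by
        rintro rfl
        have h1 := Ev.lt_iff.1 hlt
        rcases h1 with h1 | h1
        · simp at h1; omega
        · exact lt_irrefl _ h1.2
      match M a with
      | .noop => exact ⟨ih1, ih2⟩
      | .kill =>
        refine ⟨fun h => ih1 (Finset.mem_of_mem_erase h), fun A hA h => ih2 A hA ?_⟩
        exact (Finset.mem_filter.1 h).1
      | .birth C E =>
        rw [step]
        split_ifs with hacc
        · refine ⟨by simp [addSets, hau, ih1], fun A hA h => ?_⟩
          rcases Finset.mem_union.1 h with h | h
          · exact ih2 A hA h
          -- A proposal at another site whose sets pass through `u` needs `u` to be on, but `u` has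
          -- been off since its deletion.
          · have hmem : u - a.site ∈ hull C :=
              mem_hull_translateAll.1 (mem_hull.2 ⟨A, h, hA⟩)
            have := hacc.2.2.2.1 _ hmem (sub_ne_zero.2 hau)
            exact ih1 (by simpa using this)
        · exact ⟨ih1, ih2⟩

lemma notMem_limitSets_of_kill {u : IntLattice d} {M : Ev d → Mark d}
    (hM : ∀ e : Ev d, 0 ≤ e.time → M e = .noop) (hu : M (Ev.mk (-1) u) = .kill)
    {A : NonemptyFinset d} (hA : u ∈ A.1) : A ∉ limitSets T M := by
  rintro ⟨n₀, h⟩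
  obtain ⟨n, hn, hn'⟩ := ((eventually_mem_win (e := Ev.mk (-1) u) (by simp)).and
    (Filter.eventually_ge_atTop n₀)).exists
  exact (notMem_run_of_kill hM hu _ hn).2 A hA (h n hn')

/-! ### Translations of the dynamics -/

/-- The translate of a state. -/
def translateState (v : IntLattice d) (s : DynState d) : DynState d :=
  (translateAll s.1 v, s.2.map (addRightEmbedding v))

@[simp]
lemma mem_translateState_snd {u v : IntLattice d} {s : DynState d} :
    u ∈ (translateState v s).2 ↔ u - v ∈ s.2 := by
  simp only [translateState, Finset.mem_map, addRightEmbedding_apply]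
  exact ⟨by rintro ⟨a, ha, rfl⟩; simpa using ha, fun h => ⟨u - v, h, by simp⟩⟩

@[simp]
lemma mem_translateState_fst {A : NonemptyFinset d} {v : IntLattice d} {s : DynState d} :
    A ∈ (translateState v s).1 ↔ A.translate (-v) ∈ s.1 := mem_translateAll

lemma accepts_translateState {v w : IntLattice d} {C : Finset (NonemptyFinset d)}
    {E : Finset (IntLattice d)} {s : DynState d} :
    Accepts T (w + v) C E (translateState v s) ↔ Accepts T w C E s := by
  have h (y : IntLattice d) : y + (w + v) - v = y + w := by abel
  simp only [Accepts, mem_translateState_snd, add_sub_cancel_right, h]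
  simp only [translateState, mem_hull_translateAll, h]

lemma step_translateState (v w : IntLattice d) (m : Mark d) (s : DynState d) :
    step T (w + v) m (translateState v s) = translateState v (step T w m s) := by
  cases m with
  | noop => rfl
  | kill =>
    refine Prod.ext (Finset.ext fun A => ?_) (Finset.ext fun u => ?_)
    · simp [step, removeSets]
    · simp [step, removeSets, sub_eq_iff_eq_add]
  | birth C E =>
    rw [step, step]
    by_cases h : Accepts T w C E s
    · rw [if_pos h, if_pos (accepts_translateState.2 h)]
      refine Prod.ext (Finset.ext fun A => ?_) (Finset.ext fun u => ?_)
      · simp only [addSets, Finset.mem_union, mem_translateState_fst, mem_translateAll,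
          NonemptyFinset.translate_translate]
        rw [show -(w + v) = -v + -w by abel]
      · simp [addSets, sub_eq_iff_eq_add]
    · rw [if_neg h, if_neg (accepts_translateState.not.2 h)]

lemma Ev.shift_injective (v : IntLattice d) : Function.Injective (Ev.shift (d := d) v) :=
  fun e f h => by
    have h1 : (Ev.shift v e).time = (Ev.shift v f).time := congrArg Ev.time h
    have h2 : (Ev.shift v e).site = (Ev.shift v f).site := congrArg Ev.site h
    simp only [time_shift, site_shift] at h1 h2
    rw [← Ev.mk_eta e, ← Ev.mk_eta f, h1, add_right_cancel h2]

/-- The translation of events as an embedding. -/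
def Ev.shiftEmb (v : IntLattice d) : Ev d ↪ Ev d := ⟨Ev.shift v, Ev.shift_injective v⟩

lemma run_translateState (v : IntLattice d) (W : Finset (Ev d)) (M : Ev d → Mark d)
    (s : DynState d) : run T (W.map (Ev.shiftEmb v)) M (translateState v s) =
      translateState v (run T W (fun e => M (e.shift v)) s) := by
  induction W using Finset.induction_on_max with
  | empty => simp
  | insert a W ha ih =>
    rw [Finset.map_insert, run_insert, run_insert ha, ih, ← step_translateState]
    · rfl
    · simp only [Finset.mem_map]
      rintro _ ⟨b, hb, rfl⟩
      exact Ev.shift_lt_shift.2 (ha b hb)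

include hT0 hT in
-- The windows are centred at the origin and hence not translation invariant. On a certificate this
-- is harmless: every window containing it gives the same value.
lemma Determined.translate_mem_limitSets_iff {M : Ev d → Mark d} {n : ℕ}
    (n₀ : ∀ e : Ev d, 0 ≤ e.time → M e = .noop) {l : ℕ} {u : IntLattice d}
    (h : Determined T (restrictTo (win d n) M) l u (Ev.final d)) {A : NonemptyFinset d}
    (hA : u ∈ A.1) (v : IntLattice d) :
    A.translate v ∈ limitSets T (fun e => M (e.shift (-v))) ↔ A ∈ limitSets T M := by
  have key : ∀ᶠ m in Filter.atTop, (A.translate v ∈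
      (run T (win d m) (fun e => M (e.shift (-v))) (∅, ∅)).1 ↔ A ∈ limitSets T M) := by
    filter_upwards [eventually_subset_win ((win d n).map (Ev.shiftEmb v)) (by
      simp only [Finset.mem_map]
      rintro _ ⟨b, hb, rfl⟩
      exact (mem_win.1 hb).1.2)] with m hm
    have h1 := run_translateState (T := T) (-v) (win d m) M (∅, ∅)
    have h2 : win d n ⊆ (win d m).map (Ev.shiftEmb (-v)) := by
      intro e he
      rw [Finset.mem_map]
      refine ⟨e.shift v, hm (Finset.mem_map_of_mem _ he), ?_⟩
      change Ev.mk e.time (e.site + v + -v) = e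
      simp
    have h3 := h.mem_limitSets_iff hT0 hT n₀ (extends_restrictTo _ _) n₀ h2 InClass.empty hA
    rw [← h3]
    have h4 : translateState (-v) ((∅, ∅) : DynState d) = (∅, ∅) := by
      simp [translateState, translateAll]
    rw [h4] at h1
    rw [h1]
    simp
  obtain ⟨m₀, hm₀⟩ := Filter.eventually_atTop.1 key
  constructor
  · rintro ⟨m, hm⟩
    exact (hm₀ (max m₀ m) (le_max_left ..)).1 (hm _ (le_max_right ..))
  · exact fun hr => ⟨m₀, fun m hm => (hm₀ m hm).2 hr⟩

/-! ### Measurability -/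

lemma measurable_eq_mark (e : Ev d) (m : Mark d) :
    Measurable fun M : Ev d → Mark d => M e = m :=
  (Measurable.of_discrete (f := fun x : Mark d => x = m)).comp (measurable_pi_apply e)

lemma measurable_determined (n : ℕ) (u : IntLattice d) (e : Ev d) :
    Measurable fun M : Ev d → Mark d => Determined T M n u e := by
  induction n generalizing u e with
  | zero => exact measurable_const
  | succ n ih =>
    refine Measurable.exists fun k => measurable_const.and ((measurable_eq_mark _ _).and
      (Measurable.forall fun f => measurable_const.imp (measurable_const.imp
        (measurable_const.imp (measurable_const.imp ?_)))))
    refine (measurable_eq_mark f .noop).not.and (Measurable.forall fun C => Measurable.forall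
      fun E => (measurable_eq_mark _ _).imp (measurable_const.imp (measurable_const.imp
        (measurable_const.imp (Measurable.forall fun y => measurable_const.imp
          (measurable_const.imp (ih _ _)))))))

lemma measurable_run (W : Finset (Ev d)) (s : DynState d) :
    Measurable fun M : Ev d → Mark d => run T W M s := by
  induction W using Finset.induction_on_max with
  | empty => simp
  | insert a W ha ih =>
    simp only [run_insert ha]
    exact (Measurable.of_discrete (f := fun q : Mark d × DynState d => step T a.site q.1 q.2)).comp
      ((measurable_pi_apply a).prodMk ih)

lemma measurable_mem_limitSets (A : NonemptyFinset d) :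
    Measurable fun M : Ev d → Mark d => A ∈ limitSets T M := by
  refine Measurable.exists fun n₀ => Measurable.forall fun n => measurable_const.imp ?_
  exact (Measurable.of_discrete (f := fun s : DynState d => A ∈ s.1)).comp (measurable_run _ _)

end Windows

/-! ### Weights and the law of the marks -/

section Weights

open scoped NNReal ENNReal

variable {d : ℕ}

/-- The weight of a proposal. -/
noncomputable def proposalWeight (r : NonemptyFinset d → ℝ≥0) (g : ℝ≥0)
    (C : Finset (NonemptyFinset d)) (E : Finset (IntLattice d)) : ℝ≥0 :=
  (∏ A ∈ C, r A) * g * g⁻¹ ^ E.card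

/-- The total weight of all proposals. -/
noncomputable def proposalMass (T : Finset (NonemptyFinset d)) (r : NonemptyFinset d → ℝ≥0)
    (g : ℝ≥0) : ℝ≥0 :=
  ∑ C ∈ T.powerset, ∑ E ∈ (hull C).powerset, proposalWeight r g C E

/-- The probability of a deletion. -/
noncomputable def killProb (T : Finset (NonemptyFinset d)) (r : NonemptyFinset d → ℝ≥0)
    (g : ℝ≥0) : ℝ≥0 := (1 + proposalMass T r g)⁻¹

/-- The law of the marks. -/
noncomputable def markLaw (T : Finset (NonemptyFinset d)) (r : NonemptyFinset d → ℝ≥0)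
    (g : ℝ≥0) : Measure (Mark d) :=
  (killProb T r g : ℝ≥0∞) • (Measure.dirac Mark.kill +
    ∑ C ∈ T.powerset, ∑ E ∈ (hull C).powerset,
      (proposalWeight r g C E : ℝ≥0∞) • Measure.dirac (Mark.birth C E))

variable (T : Finset (NonemptyFinset d)) (r : NonemptyFinset d → ℝ≥0) (g : ℝ≥0)

lemma lintegral_markLaw (f : Mark d → ℝ≥0∞) :
    ∫⁻ m, f m ∂(markLaw T r g) = killProb T r g * (f .kill +
      ∑ C ∈ T.powerset, ∑ E ∈ (hull C).powerset, proposalWeight r g C E * f (.birth C E)) := by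
  simp only [markLaw, lintegral_smul_measure, lintegral_add_measure, lintegral_dirac,
    lintegral_finsetSum_measure, smul_eq_mul]

lemma killProb_mul : (killProb T r g : ℝ≥0∞) * (1 + proposalMass T r g) = 1 := by
  have h : (1 + proposalMass T r g) ≠ 0 := by positivity
  have : killProb T r g * (1 + proposalMass T r g) = 1 := inv_mul_cancel₀ h
  exact_mod_cast this

instance : IsProbabilityMeasure (markLaw T r g) := ⟨by
  rw [← lintegral_one, lintegral_markLaw]
  simp only [mul_one]
  have h := killProb_mul T r g
  rw [proposalMass] at h
  push_cast at h
  exact h⟩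

lemma markLaw_kill : markLaw T r g {.kill} = killProb T r g := by
  rw [← lintegral_indicator_one (measurableSet_singleton _), lintegral_markLaw]
  simp

/-- Since `noop` is never drawn, it is free to stand for an unknown mark in certificates. -/
lemma markLaw_noop : markLaw T r g {.noop} = 0 := by
  rw [← lintegral_indicator_one (measurableSet_singleton _), lintegral_markLaw]
  simp

lemma markLaw_birth {C : Finset (NonemptyFinset d)} {E : Finset (IntLattice d)} (hC : C ⊆ T)
    (hE : E ⊆ hull C) :
    markLaw T r g {.birth C E} = killProb T r g * proposalWeight r g C E := by
  classical
  rw [← lintegral_indicator_one (measurableSet_singleton _), lintegral_markLaw]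
  rw [Finset.sum_eq_single_of_mem C (by simpa)
    (fun C' _ hne => by simp [hne]),
    Finset.sum_eq_single_of_mem E (by simpa) (fun E' _ hne => by simp [hne])]
  simp

lemma sum_inv_pow_powerset {α : Type*} (s : Finset α) (y : ℝ≥0) :
    ∑ E ∈ s.powerset, y ^ E.card = (1 + y) ^ s.card := by
  simpa using (Finset.prod_one_add (f := fun _ => y) s).symm

/-- The sets of the class of `T` that lie in `V`. -/
noncomputable def classIn (V : Finset (IntLattice d)) : Finset (NonemptyFinset d) := by
  classical exact
    {A ∈ (T ×ˢ V).image fun q => q.1.translate q.2 | A.1 ⊆ V ∧ ∀ u ∈ A.1, A.translate (-u) ∈ T}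

variable {T} in
lemma mem_classIn {V : Finset (IntLattice d)} {A : NonemptyFinset d} :
    A ∈ classIn T V ↔ A.1 ⊆ V ∧ ∀ u ∈ A.1, A.translate (-u) ∈ T := by
  classical
  simp only [classIn, Finset.mem_filter, and_iff_right_iff_imp]
  rintro ⟨h1, h2⟩
  obtain ⟨u, hu⟩ := A.2
  exact Finset.mem_image.2 ⟨(A.translate (-u), u), Finset.mem_product.2 ⟨h2 u hu, h1 hu⟩, by simp⟩

/-- The admissible states in `V`. -/
noncomputable def statesIn (V : Finset (IntLattice d)) : Finset (DynState d) := by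
  classical exact {s ∈ (classIn T V).powerset ×ˢ V.powerset | hull s.1 ⊆ s.2}

variable {T} in
lemma mem_statesIn {V : Finset (IntLattice d)} {s : DynState d} :
    s ∈ statesIn T V ↔ (s.1 ⊆ classIn T V ∧ s.2 ⊆ V) ∧ hull s.1 ⊆ s.2 := by
  classical
  simp [statesIn]

variable {T} in
lemma InClass.of_mem_statesIn {V : Finset (IntLattice d)} {s : DynState d}
    (hs : s ∈ statesIn T V) : InClass T s :=
  fun _ hA => (mem_classIn.1 ((mem_statesIn.1 hs).1.1 hA)).2

/-- The stationary weight of a state. -/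
noncomputable def stateWeight (s : DynState d) : ℝ≥0 :=
  (∏ A ∈ s.1, r A) * g ^ s.2.card * (1 + g⁻¹) ^ (hull s.1).card

/-- The sites around `w` that a proposal needs are on. -/
def Ready (w : IntLattice d) (C : Finset (NonemptyFinset d)) (s : DynState d) : Prop :=
  ∀ y ∈ hull C, y ≠ 0 → y + w ∈ s.2

variable {T r g}

open Classical in
-- The accepted `E` are the subsets of the newly covered sites, and the sum of `g⁻¹ ^ E.card` over
-- them is `1 + g⁻¹` to the number of these sites, exactly the growth of the covering factor. The
-- factor `g` pays for switching `w` on. Testing a random `E` thus turns a rate depending on the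
-- state into a fixed law of marks.
lemma stateWeight_addSets (hT0 : ∀ A ∈ T, 0 ∈ A.1)
    (hr : ∀ (A : NonemptyFinset d) (v : IntLattice d), r (A.translate v) = r A)
    {w : IntLattice d} {C : Finset (NonemptyFinset d)} (hC : C ⊆ T) {s : DynState d}
    (hs : hull s.1 ⊆ s.2) (hw : w ∉ s.2) :
    stateWeight r g (addSets w C s) = stateWeight r g s *
      ∑ E ∈ (hull C).powerset with ∀ y ∈ E, y + w ∉ hull s.1, proposalWeight r g C E := by
  have hdisj : Disjoint s.1 (translateAll C w) := by
    rw [Finset.disjoint_left]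
    intro A hA hA'
    refine hw (hs (mem_hull.2 ⟨A, hA, ?_⟩))
    simpa using hT0 _ (hC (mem_translateAll.1 hA'))
  have h1 : ∏ A ∈ translateAll C w, r A = ∏ A ∈ C, r A := by
    simp [translateAll, hr]
  have h2 : (hull (s.1 ∪ translateAll C w)).card =
      (hull s.1).card + {y ∈ hull C | y + w ∉ hull s.1}.card := by
    rw [hull_union, Finset.card_union, ← Finset.card_map (addRightEmbedding w)
      (s := {y ∈ hull C | y + w ∉ hull s.1})]
    have : (Finset.map (addRightEmbedding w) {y ∈ hull C | y + w ∉ hull s.1}) =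
        hull (translateAll C w) \ hull s.1 := by
      ext u
      simp only [Finset.mem_map, Finset.mem_filter, addRightEmbedding_apply, Finset.mem_sdiff,
        mem_hull_translateAll]
      constructor
      · rintro ⟨y, hy, rfl⟩; simpa using hy
      · exact fun h => ⟨u - w, by simpa using h, by simp⟩
    rw [this, Finset.card_sdiff]
    have h3 := Finset.card_le_card (Finset.inter_subset_left (s₁ := hull (translateAll C w))
      (s₂ := hull s.1))
    rw [Finset.inter_comm] at h3
    rw [Nat.add_sub_assoc h3]
  have h4 : ((hull C).powerset.filter fun E => ∀ y ∈ E, y + w ∉ hull s.1) =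
      ({y ∈ hull C | y + w ∉ hull s.1}).powerset := by
    ext E
    simp only [Finset.mem_filter, Finset.mem_powerset, Finset.subset_iff]
    exact ⟨fun h y hy => ⟨h.1 hy, h.2 y hy⟩, fun h => ⟨fun y hy => (h hy).1, fun y hy => (h hy).2⟩⟩
  rw [h4]
  simp only [proposalWeight]
  rw [← Finset.mul_sum, sum_inv_pow_powerset]
  simp only [stateWeight, addSets]
  rw [Finset.prod_union hdisj, h1, h2, Finset.card_insert_of_notMem hw, pow_succ, pow_add]
  ring

open Classical in
/-- States with `w` on correspond to states with `w` off together with an accepted proposal. -/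
lemma sum_states_on (hT0 : ∀ A ∈ T, 0 ∈ A.1)
    (hT : ∀ A ∈ T, ∀ u ∈ A.1, A.translate (-u) ∈ T)
    {V : Finset (IntLattice d)} {w : IntLattice d} (hw : w ∈ V)
    (f : DynState d → DynState d → ℝ≥0∞) :
    ∑ s ∈ statesIn T V with w ∈ s.2, f (removeSets w s) s =
      ∑ s ∈ statesIn T V with w ∉ s.2, ∑ C ∈ T.powerset with Ready w C s,
        f s (addSets w C s) := by
  rw [Finset.sum_sigma']
  have hrem : ∀ s : DynState d, w ∈ s.2 → InClass T s → addSets w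
      (translateAll {A ∈ s.1 | w ∈ A.1} (-w)) (removeSets w s) = s := by
    intro s hws hs
    refine Prod.ext (Finset.ext fun A => ?_) (Finset.insert_erase hws)
    simp only [addSets, removeSets, Finset.mem_union, Finset.mem_filter, mem_translateAll,
      NonemptyFinset.translate_translate]
    simp
    tauto
  have hadd : ∀ s : DynState d, w ∉ s.2 → hull s.1 ⊆ s.2 → ∀ C ⊆ T,
      removeSets w (addSets w C s) = s ∧
        translateAll {A ∈ (addSets w C s).1 | w ∈ A.1} (-w) = C := by
    intro s hws hs C hC
    have h1 : ∀ A ∈ s.1, w ∉ A.1 := fun A hA hwA => hws (hs (mem_hull.2 ⟨A, hA, hwA⟩))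
    have h2 : ∀ A : NonemptyFinset d, A.translate (-w) ∈ C → w ∈ A.1 := fun A hA => by
      simpa using hT0 _ (hC hA)
    refine ⟨Prod.ext (Finset.ext fun A => ?_) (Finset.erase_insert hws), Finset.ext fun A => ?_⟩
    · simp only [addSets, removeSets, Finset.mem_filter, Finset.mem_union, mem_translateAll]
      exact ⟨fun h => h.1.resolve_right fun h' => h.2 (h2 A h'), fun h => ⟨Or.inl h, h1 A h⟩⟩
    · simp only [addSets, Finset.mem_filter, Finset.mem_union, mem_translateAll,
        NonemptyFinset.translate_translate]
      simp only [neg_neg, add_neg_cancel, NonemptyFinset.translate_zero]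
      constructor
      · rintro ⟨h | h, h'⟩
        · exact absurd h' (h1 _ h)
        · exact h
      · exact fun h => ⟨Or.inr h, by simpa using hT0 _ (hC h)⟩
  refine Finset.sum_bij' (fun s _ => ⟨removeSets w s, translateAll {A ∈ s.1 | w ∈ A.1} (-w)⟩)
    (fun q _ => addSets w q.2 q.1) ?_ ?_ ?_ ?_ ?_
  · intro s hs
    obtain ⟨hs, hws⟩ := Finset.mem_filter.1 hs
    have hs' := mem_statesIn.1 hs
    have hcl := InClass.of_mem_statesIn hs
    simp only [Finset.mem_sigma, Finset.mem_filter, Finset.mem_powerset, mem_statesIn]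
    refine ⟨⟨⟨⟨fun A hA => hs'.1.1 (Finset.mem_filter.1 hA).1,
      (Finset.erase_subset _ _).trans hs'.1.2⟩, fun u hu => ?_⟩, by simp [removeSets]⟩,
      fun A hA => ?_, fun y hy hy0 => ?_⟩
    · obtain ⟨A, hA, hu⟩ := mem_hull.1 hu
      obtain ⟨hA, hwA⟩ := Finset.mem_filter.1 hA
      refine Finset.mem_erase.2 ⟨fun h => hwA (h ▸ hu), hs'.2 (mem_hull.2 ⟨A, hA, hu⟩)⟩
    · simp only [mem_translateAll, Finset.mem_filter, neg_neg] at hA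
      simpa using hcl _ hA.1 w hA.2
    · rw [mem_hull_translateAll] at hy
      obtain ⟨A, hA, hu⟩ := mem_hull.1 hy
      have := hs'.2 (mem_hull.2 ⟨A, (Finset.mem_filter.1 hA).1, hu⟩)
      refine Finset.mem_erase.2 ⟨fun h => hy0 (by simpa using h), by simpa using this⟩
  · rintro ⟨s, C⟩ hq
    simp only [Finset.mem_sigma, Finset.mem_filter, Finset.mem_powerset] at hq
    obtain ⟨⟨hs, hws⟩, hC, hready⟩ := hq
    have hs' := mem_statesIn.1 hs
    have hsub : hull (addSets w C s).1 ⊆ (addSets w C s).2 := by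
      simp only [addSets, hull_union]
      refine Finset.union_subset (hs'.2.trans (Finset.subset_insert _ _)) fun u hu => ?_
      rw [mem_hull_translateAll] at hu
      by_cases huw : u = w
      · simp [huw]
      · have := hready _ hu (sub_ne_zero.2 huw)
        exact Finset.mem_insert_of_mem (by simpa using this)
    have hV : (addSets w C s).2 ⊆ V := Finset.insert_subset hw hs'.1.2
    refine Finset.mem_filter.2 ⟨mem_statesIn.2 ⟨⟨fun A hA => ?_, hV⟩, hsub⟩, by simp [addSets]⟩
    refine mem_classIn.2 ⟨fun u hu => hV (hsub (mem_hull.2 ⟨A, hA, hu⟩)), ?_⟩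
    rcases Finset.mem_union.1 hA with h | h
    · exact (mem_classIn.1 (hs'.1.1 h)).2
    · intro u hu
      have := hT _ (hC (mem_translateAll.1 h)) (u - w) (by simpa using hu)
      rwa [NonemptyFinset.translate_translate, show -w + -(u - w) = -u by abel] at this
  · intro s hs
    obtain ⟨hs, hws⟩ := Finset.mem_filter.1 hs
    exact hrem s hws (InClass.of_mem_statesIn hs)
  · rintro ⟨s, C⟩ hq
    simp only [Finset.mem_sigma, Finset.mem_filter, Finset.mem_powerset] at hq
    obtain ⟨⟨hs, hws⟩, hC, -⟩ := hq
    obtain ⟨h1, h2⟩ := hadd s hws (mem_statesIn.1 hs).2 C hC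
    simp [h1, h2]
  · intro s hs
    obtain ⟨hs, hws⟩ := Finset.mem_filter.1 hs
    rw [hrem s hws (InClass.of_mem_statesIn hs)]

open Classical in
/-- The weights of the states are stationary for the update at a site. -/
theorem sum_stateWeight_step (hT0 : ∀ A ∈ T, 0 ∈ A.1)
    (hT : ∀ A ∈ T, ∀ u ∈ A.1, A.translate (-u) ∈ T)
    (hr : ∀ (A : NonemptyFinset d) (v : IntLattice d), r (A.translate v) = r A)
    {V : Finset (IntLattice d)} {w : IntLattice d} (hw : w ∈ V) (φ : DynState d → ℝ≥0∞) :
    ∑ s ∈ statesIn T V, stateWeight r g s * ∫⁻ m, φ (step T w m s) ∂(markLaw T r g) =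
      ∑ s ∈ statesIn T V, stateWeight r g s * φ s := by
  set π : DynState d → ℝ≥0∞ := fun s => stateWeight r g s with hπ
  -- Deletions from states with `w` on carry to each `s` with `w` off the mass that its accepted
  -- proposals send out.
  have hkill : ∑ s ∈ statesIn T V, π s * φ (removeSets w s) =
      ∑ s ∈ statesIn T V with w ∉ s.2, π s * φ s +
      ∑ s ∈ statesIn T V with w ∉ s.2, ∑ C ∈ T.powerset with Ready w C s,
        ∑ E ∈ (hull C).powerset with ∀ y ∈ E, y + w ∉ hull s.1,
          π s * (proposalWeight r g C E * φ s) := by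
    rw [← Finset.sum_filter_add_sum_filter_not _ (fun s : DynState d => w ∉ s.2)]
    congr 1
    · refine Finset.sum_congr rfl fun s hs => ?_
      obtain ⟨hs, hws⟩ := Finset.mem_filter.1 hs
      congr 2
      refine Prod.ext (Finset.filter_true_of_mem fun A hA hwA => ?_) (Finset.erase_eq_of_notMem hws)
      exact hws ((mem_statesIn.1 hs).2 (mem_hull.2 ⟨A, hA, hwA⟩))
    · simp only [not_not]
      rw [sum_states_on hT0 hT hw fun s s' => π s' * φ s]
      refine Finset.sum_congr rfl fun s hs => Finset.sum_congr rfl fun C hC => ?_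
      obtain ⟨hs, hws⟩ := Finset.mem_filter.1 hs
      have hC' := Finset.mem_powerset.1 (Finset.mem_filter.1 hC).1
      simp only [hπ]
      rw [stateWeight_addSets hT0 hr hC' (mem_statesIn.1 hs).2 hws]
      push_cast
      rw [mul_assoc, Finset.sum_mul, Finset.mul_sum]
  -- Accepted proposals fill exactly the states with `w` on.
  have hbirth : ∑ s ∈ statesIn T V with w ∉ s.2, ∑ C ∈ T.powerset with Ready w C s,
        ∑ E ∈ (hull C).powerset with ∀ y ∈ E, y + w ∉ hull s.1,
          π s * (proposalWeight r g C E * φ (addSets w C s)) =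
      ∑ s ∈ statesIn T V with w ∈ s.2, π s * φ s := by
    rw [sum_states_on hT0 hT hw fun s s' => π s' * φ s']
    refine Finset.sum_congr rfl fun s hs => Finset.sum_congr rfl fun C hC => ?_
    obtain ⟨hs, hws⟩ := Finset.mem_filter.1 hs
    have hC' := Finset.mem_powerset.1 (Finset.mem_filter.1 hC).1
    simp only [hπ]
    rw [stateWeight_addSets hT0 hr hC' (mem_statesIn.1 hs).2 hws]
    push_cast
    rw [mul_assoc, Finset.sum_mul, Finset.mul_sum]
  -- the sum over accepted proposals, written as a sum with indicators
  have hacc : ∀ F : DynState d → Finset (NonemptyFinset d) → Finset (IntLattice d) → ℝ≥0∞,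
      ∑ s ∈ statesIn T V with w ∉ s.2, ∑ C ∈ T.powerset with Ready w C s,
        ∑ E ∈ (hull C).powerset with ∀ y ∈ E, y + w ∉ hull s.1, F s C E =
      ∑ s ∈ statesIn T V, ∑ C ∈ T.powerset, ∑ E ∈ (hull C).powerset,
        if Accepts T w C E s then F s C E else 0 := by
    intro F
    rw [Finset.sum_filter]
    refine Finset.sum_congr rfl fun s _ => ?_
    by_cases hws : w ∉ s.2
    · rw [if_pos hws, Finset.sum_filter]
      refine Finset.sum_congr rfl fun C hC => ?_
      by_cases hready : Ready w C s
      · rw [if_pos hready, Finset.sum_filter]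
        refine Finset.sum_congr rfl fun E hE => ?_
        refine if_congr ⟨fun h => ?_, fun h => h.2.2.2.2⟩ rfl rfl
        exact ⟨Finset.mem_powerset.1 hC, Finset.mem_powerset.1 hE, hws, hready, h⟩
      · rw [if_neg hready, Finset.sum_eq_zero]
        exact fun E _ => if_neg fun h => hready h.2.2.2.1
    · rw [if_neg hws]
      symm
      refine Finset.sum_eq_zero fun C _ => Finset.sum_eq_zero fun E _ => if_neg fun h => hws h.2.2.1
  rw [hacc] at hkill hbirth
  have hsplit : ∑ s ∈ statesIn T V, π s * φ s =
      ∑ s ∈ statesIn T V with w ∉ s.2, π s * φ s + ∑ s ∈ statesIn T V with w ∈ s.2, π s * φ s := by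
    rw [← Finset.sum_filter_add_sum_filter_not _ (fun s : DynState d => w ∉ s.2)]
    simp
  calc ∑ s ∈ statesIn T V, π s * ∫⁻ m, φ (step T w m s) ∂(markLaw T r g)
      = killProb T r g * (∑ s ∈ statesIn T V, π s * φ (removeSets w s) +
          ∑ s ∈ statesIn T V, ∑ C ∈ T.powerset, ∑ E ∈ (hull C).powerset,
            π s * (proposalWeight r g C E * φ (step T w (.birth C E) s))) := by
        rw [← Finset.sum_add_distrib, Finset.mul_sum]
        refine Finset.sum_congr rfl fun s _ => ?_
        rw [lintegral_markLaw]
        simp only [← Finset.mul_sum]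
        rw [← mul_add, mul_left_comm]
        rfl
    _ = killProb T r g * (∑ s ∈ statesIn T V, π s * φ s +
          ∑ s ∈ statesIn T V, ∑ C ∈ T.powerset, ∑ E ∈ (hull C).powerset,
            π s * (proposalWeight r g C E * φ s)) := by
        congr 1
        -- The mass returned by deletions is indexed by the accepted proposals at `s`; together with
        -- the rejected proposals, which stay at `s`, every proposal contributes `φ s` exactly once.
        rw [hkill, hsplit, ← hbirth, add_assoc, add_assoc, ← Finset.sum_add_distrib,
          ← Finset.sum_add_distrib]
        congr 1
        refine Finset.sum_congr rfl fun s _ => ?_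
        rw [← Finset.sum_add_distrib, ← Finset.sum_add_distrib]
        refine Finset.sum_congr rfl fun C _ => ?_
        rw [← Finset.sum_add_distrib, ← Finset.sum_add_distrib]
        refine Finset.sum_congr rfl fun E _ => ?_
        rw [step]
        by_cases h : Accepts T w C E s
        · rw [if_pos h, if_pos h, if_pos h, add_comm]
        · rw [if_neg h, if_neg h, if_neg h]
    _ = killProb T r g * (1 + proposalMass T r g) * ∑ s ∈ statesIn T V, π s * φ s := by
        rw [mul_assoc, add_mul, one_mul, proposalMass]
        congr 2
        rw [Finset.mul_sum]
        refine Finset.sum_congr rfl fun s _ => ?_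
        push_cast
        rw [Finset.sum_mul]
        refine Finset.sum_congr rfl fun C _ => ?_
        rw [Finset.sum_mul]
        refine Finset.sum_congr rfl fun E _ => ?_
        ring
    _ = ∑ s ∈ statesIn T V, π s * φ s := by rw [killProb_mul, one_mul]

end Weights

/-! ### Independence of blocks of coordinates -/

section Blocks

variable {Ω ι β : Type*} [MeasurableSpace β]

/-- The σ-algebra generated by the coordinates in `D`. -/
@[reducible]
def blockAlgebra (m : ι → Ω → β) (D : Set ι) : MeasurableSpace Ω :=
  ⨆ i ∈ D, MeasurableSpace.comap (m i) inferInstance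

open Classical in
/-- The configuration that equals `m` on `D` and `c` elsewhere. -/
noncomputable def blockConfig (m : ι → Ω → β) (D : Set ι) (c : β) (ω : Ω) (i : ι) : β :=
  if i ∈ D then m i ω else c

lemma measurable_blockConfig (m : ι → Ω → β) (D : Set ι) (c : β) :
    Measurable[blockAlgebra m D] (blockConfig m D c) := by
  refine @measurable_pi_lambda _ _ _ (blockAlgebra m D) _ _ fun i => ?_
  by_cases hi : i ∈ D
  · simp only [blockConfig, hi, if_true]
    exact measurable_iff_comap_le.2
      (le_iSup₂_of_le (f := fun i (_ : i ∈ D) => MeasurableSpace.comap (m i) inferInstance)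
        i hi le_rfl)
  · simp only [blockConfig, hi, if_false]
    exact measurable_const

lemma measurable_blockAlgebra_of_mem {m : ι → Ω → β} {D : Set ι} {i : ι} (hi : i ∈ D) :
    Measurable[blockAlgebra m D] (m i) :=
  measurable_iff_comap_le.2
    (le_iSup₂_of_le (f := fun i (_ : i ∈ D) => MeasurableSpace.comap (m i) inferInstance)
      i hi le_rfl)

lemma blockAlgebra_le [MeasurableSpace Ω] {m : ι → Ω → β} (hm : ∀ i, Measurable (m i)) (D : Set ι) :
    blockAlgebra m D ≤ (inferInstance : MeasurableSpace Ω) :=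
  iSup₂_le fun i _ => (hm i).comap_le

lemma indep_blockAlgebra [MeasurableSpace Ω] {m : ι → Ω → β} {Q : Measure Ω} (hm : ∀ i, Measurable (m i))
    (hi : iIndepFun m Q) {D D' : Set ι} (h : Disjoint D D') :
    Indep (blockAlgebra m D) (blockAlgebra m D') Q :=
  indep_iSup_of_disjoint (fun i => (hm i).comap_le) hi.iIndep h

end Blocks

/-! ### Random marks -/

section RandomMarks

open scoped NNReal ENNReal

variable {d : ℕ} {Ω : Type*} [MeasurableSpace Ω] {Q : Measure Ω} [IsProbabilityMeasure Q]
  {T : Finset (NonemptyFinset d)} {r : NonemptyFinset d → ℝ≥0} {g : ℝ≥0} {m : Ev d → Ω → Mark d}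

/-- The marks of the events before time `0`. -/
def past (M : Ev d → Mark d) (e : Ev d) : Mark d := if e.time < 0 then M e else .noop

lemma past_of_nonneg (M : Ev d → Mark d) {e : Ev d} (he : 0 ≤ e.time) : past M e = .noop :=
  if_neg he.not_gt

lemma past_of_neg (M : Ev d → Mark d) {e : Ev d} (he : e.time < 0) : past M e = M e := if_pos he

lemma measurable_past : Measurable (past (d := d)) := by
  refine measurable_pi_lambda _ fun e => ?_
  by_cases he : e.time < 0
  · simpa [past, he] using measurable_pi_apply e
  · simp [past, he]

lemma measurable_restrictTo (W : Finset (Ev d)) : Measurable (restrictTo W) := by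
  refine measurable_pi_lambda _ fun e => ?_
  by_cases he : e ∈ W
  · simpa [restrictTo, he] using measurable_pi_apply e
  · simp [restrictTo, he]

/-- The law of the marks is preserved by the run of the dynamics. -/
lemma sum_stateWeight_run (hm : ∀ e, Measurable (m e)) (hi : iIndepFun m Q)
    (hlaw : ∀ e, Q.map (m e) = markLaw T r g) (hT0 : ∀ A ∈ T, 0 ∈ A.1)
    (hT : ∀ A ∈ T, ∀ u ∈ A.1, A.translate (-u) ∈ T)
    (hr : ∀ (A : NonemptyFinset d) (v : IntLattice d), r (A.translate v) = r A)
    {V : Finset (IntLattice d)} {W : Finset (Ev d)} (hW : ∀ e ∈ W, e.site ∈ V)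
    (φ : DynState d → ℝ≥0∞) :
    ∑ s ∈ statesIn T V, stateWeight r g s * ∫⁻ ω, φ (run T W (fun e => m e ω) s) ∂Q =
      ∑ s ∈ statesIn T V, stateWeight r g s * φ s := by
  induction W using Finset.induction_on_max generalizing φ with
  | empty => simp
  | insert a W ha ih =>
    specialize ih fun e he => hW e (Finset.mem_insert_of_mem he)
    -- The mark of the latest event is independent of the earlier run, so it can be integrated out
    -- and absorbed into the test function.
    have key : ∀ s, ∫⁻ ω, φ (run T (insert a W) (fun e => m e ω) s) ∂Q =
        ∫⁻ ω, (fun s' => ∫⁻ x, φ (step T a.site x s') ∂(markLaw T r g))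
          (run T W (fun e => m e ω) s) ∂Q := by
      intro s
      have hYeq : (fun ω => run T W (fun e => m e ω) s) =
          fun ω => run T W (blockConfig m (W : Set (Ev d)) .noop ω) s := by
        funext ω
        exact run_congr (fun e he => by simp [blockConfig, he]) s
      have hYb : Measurable[blockAlgebra m (W : Set (Ev d))]
          fun ω => run T W (fun e => m e ω) s := by
        rw [hYeq]
        exact (measurable_run W s).comp (measurable_blockConfig m _ _)
      have hY : Measurable fun ω => run T W (fun e => m e ω) s :=
        hYb.mono (blockAlgebra_le hm _) le_rfl
      have hind : IndepFun (fun ω => run T W (fun e => m e ω) s) (m a) Q := by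
        rw [IndepFun_iff_Indep]
        refine indep_of_indep_of_le_left (indep_of_indep_of_le_right
          (indep_blockAlgebra hm hi (D := (W : Set (Ev d))) (D' := {a}) ?_) ?_) ?_
        · rw [Set.disjoint_singleton_right]
          exact fun h => (ha a h).false
        · exact (measurable_blockAlgebra_of_mem (Set.mem_singleton a)).comap_le
        · exact hYb.comap_le
      have hprod := (indepFun_iff_map_prod_eq_prod_map_map hY.aemeasurable
        (hm a).aemeasurable).1 hind
      rw [hlaw a] at hprod
      have hG : Measurable fun q : DynState d × Mark d => φ (step T a.site q.2 q.1) :=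
        Measurable.of_discrete
      calc ∫⁻ ω, φ (run T (insert a W) (fun e => m e ω) s) ∂Q
          = ∫⁻ ω, (fun q : DynState d × Mark d => φ (step T a.site q.2 q.1))
              (run T W (fun e => m e ω) s, m a ω) ∂Q := by simp only [run_insert ha]
        _ = ∫⁻ q, φ (step T a.site q.2 q.1)
              ∂(Q.map fun ω => (run T W (fun e => m e ω) s, m a ω)) := by
            rw [lintegral_map hG (hY.prodMk (hm a))]
        _ = _ := by
            rw [hprod, lintegral_prod _ hG.aemeasurable, lintegral_map Measurable.of_discrete hY]
    simp only [key]
    rw [ih fun s' => ∫⁻ x, φ (step T a.site x s') ∂(markLaw T r g), sum_stateWeight_step hT0 hT hr (hW a (Finset.mem_insert_self ..))]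

/-! ### The probability of a failure of the search -/

omit [IsProbabilityMeasure Q] in
lemma measure_birth_inter_noKill (hm : ∀ e, Measurable (m e)) (hi : iIndepFun m Q)
    (hlaw : ∀ e, Q.map (m e) = markLaw T r g) (x : Mark d) (f : Ev d) (u : IntLattice d) (j : ℤ) :
    Q {ω | m f ω = x ∧ ∀ i, f.time < i → i < j → m (Ev.mk i u) ω ≠ .kill} =
      markLaw T r g {x} * (markLaw T r g {.kill}ᶜ) ^ (j - f.time - 1).toNat := by
  classical
  set S := (Finset.Ioo f.time j).image fun i => Ev.mk i u with hS
  have hf : f ∉ S := by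
    simp only [hS, Finset.mem_image, Finset.mem_Ioo, not_exists, not_and]
    rintro i hi rfl
    simp at hi
  have hne : ∀ e ∈ S, e ≠ f := fun e he h => hf (h ▸ he)
  have hset : {ω | m f ω = x ∧ ∀ i, f.time < i → i < j → m (Ev.mk i u) ω ≠ .kill} =
      ⋂ e ∈ insert f S, m e ⁻¹' (if e = f then {x} else {.kill}ᶜ) := by
    ext ω
    simp only [Set.mem_ofPred_eq, Finset.mem_insert, Set.mem_iInter, Set.mem_preimage]
    constructor
    · rintro ⟨h1, h2⟩ e (rfl | he)
      · simpa using h1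
      · rw [if_neg (hne e he)]
        obtain ⟨i, hi, rfl⟩ := Finset.mem_image.1 he
        exact h2 i (Finset.mem_Ioo.1 hi).1 (Finset.mem_Ioo.1 hi).2
    · intro h
      refine ⟨by simpa using h f (Or.inl rfl), fun i h1 h2 => ?_⟩
      have hmem : Ev.mk i u ∈ S := Finset.mem_image_of_mem _ (Finset.mem_Ioo.2 ⟨h1, h2⟩)
      have := h (Ev.mk i u) (Or.inr hmem)
      rw [if_neg (hne _ hmem)] at this
      exact this
  have hmap : ∀ e (t : Set (Mark d)), Q (m e ⁻¹' t) = markLaw T r g t := fun e t => by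
    rw [← hlaw e, Measure.map_apply (hm e) (MeasurableSet.of_discrete)]
  rw [hset, hi.measure_inter_preimage_eq_mul _ (fun _ _ => MeasurableSet.of_discrete),
    Finset.prod_insert hf, if_pos rfl, hmap]
  congr 1
  rw [Finset.prod_congr rfl (g := fun _ => markLaw T r g {.kill}ᶜ) fun e he => by
    rw [if_neg (hne e he), hmap], Finset.prod_const, hS,
    Finset.card_image_of_injective _ fun i k h => (Ev.mk_injective h).1, Int.card_Ioo]

lemma killProb_pos : 0 < killProb T r g := by
  unfold killProb; positivity

lemma killProb_le_one : killProb T r g ≤ 1 := by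
  unfold killProb
  exact inv_le_one_of_one_le₀ (le_add_of_nonneg_right zero_le)

lemma markLaw_compl_kill : markLaw T r g {.kill}ᶜ = 1 - killProb T r g := by
  rw [prob_compl_eq_one_sub (MeasurableSet.of_discrete), markLaw_kill]

omit [IsProbabilityMeasure Q] in
lemma ae_exists_kill (hm : ∀ e, Measurable (m e)) (hi : iIndepFun m Q)
    (hlaw : ∀ e, Q.map (m e) = markLaw T r g) (u : IntLattice d) (j : ℤ) :
    ∀ᵐ ω ∂Q, ∃ i < j, m (Ev.mk i u) ω = .kill := by
  rw [ae_iff]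
  have hlt : markLaw T r g {.kill}ᶜ < 1 := by
    rw [markLaw_compl_kill]
    refine ENNReal.sub_lt_self ENNReal.one_ne_top one_ne_zero ?_
    exact_mod_cast killProb_pos.ne'
  have hle : ∀ n : ℕ, Q {ω | ¬ ∃ i < j, m (Ev.mk i u) ω = .kill} ≤
      (markLaw T r g {.kill}ᶜ) ^ n := by
    intro n
    have hset : {ω | ¬ ∃ i < j, m (Ev.mk i u) ω = .kill} ⊆
        ⋂ e ∈ (Finset.Ico (j - n) j).image (fun i => Ev.mk i u), m e ⁻¹' {.kill}ᶜ := by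
      intro ω hω
      simp only [Finset.mem_image, Set.mem_iInter]
      rintro _ ⟨i, hi, rfl⟩
      exact fun h => hω ⟨i, (Finset.mem_Ico.1 hi).2, h⟩
    refine (measure_mono hset).trans ?_
    rw [hi.measure_inter_preimage_eq_mul _ (fun _ _ => MeasurableSet.of_discrete),
      Finset.prod_congr rfl (g := fun _ => markLaw T r g {.kill}ᶜ) fun e he => by
        rw [← hlaw e, Measure.map_apply (hm e) (MeasurableSet.of_discrete)], Finset.prod_const,
      Finset.card_image_of_injective _ fun i k h => (Ev.mk_injective h).1, Int.card_Ico]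
    simp
  exact le_antisymm (ge_of_tendsto' (ENNReal.tendsto_pow_atTop_nhds_zero_of_lt_one hlt) hle)
    zero_le

omit [IsProbabilityMeasure Q] in
lemma ae_ne_noop (hm : ∀ e, Measurable (m e)) (hlaw : ∀ e, Q.map (m e) = markLaw T r g) :
    ∀ᵐ ω ∂Q, ∀ e, m e ω ≠ .noop := by
  rw [ae_all_iff]
  intro e
  rw [ae_iff]
  simp only [not_not]
  have : Q (m e ⁻¹' {.noop}) = 0 := by
    rw [← Measure.map_apply (hm e) (MeasurableSet.of_discrete), hlaw, markLaw_noop]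
  exact this

/-- `Determined` only depends on the marks of earlier events. -/
lemma determined_congr {M M' : Ev d → Mark d} {n : ℕ} {u : IntLattice d} {e : Ev d}
    (h : ∀ f < e, M f = M' f) (hd : Determined T M n u e) : Determined T M' n u e := by
  induction n generalizing u e with
  | zero => exact hd.elim
  | succ n ih =>
    obtain ⟨k, hk, hkill, hd⟩ := hd
    refine ⟨k, hk, by rw [← h _ hk, hkill], fun f h1 h2 h3 h4 => ?_⟩
    rw [← h f h2]
    obtain ⟨hne, hd⟩ := hd f h1 h2 h3 h4
    exact ⟨hne, fun C E hC h5 h6 h7 y hy hyu =>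
      ih (fun f' hf' => h f' (hf'.trans h2)) (hd C E hC h5 h6 h7 y hy hyu)⟩

omit [MeasurableSpace Ω] in
-- Only marks before `e` enter, which makes the search below a birth independent of that birth and
-- of all later deletions.
lemma measurableSet_not_determined (n : ℕ) (u : IntLattice d) (e : Ev d) :
    MeasurableSet[blockAlgebra m (Set.Iio e)]
      {ω | ¬ Determined T (past fun f => m f ω) n u e} := by
  have h : {ω | ¬ Determined T (past fun f => m f ω) n u e} =
      {ω | ¬ Determined T (past (blockConfig m (Set.Iio e) .noop ω)) n u e} := by
    ext ω
    refine not_congr ⟨determined_congr fun f hf => ?_, determined_congr fun f hf => ?_⟩ <;>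
    simp [past, blockConfig, hf]
  rw [h]
  have := ((measurable_determined (T := T) n u e).comp measurable_past).not.comp
    (measurable_blockConfig m (Set.Iio e) .noop)
  exact @measurableSet_setOfPred _ (blockAlgebra m (Set.Iio e)) _ |>.2 this

/-- The first step of a failing search. -/
lemma exists_of_not_determined {M : Ev d → Mark d} (hM : ∀ e, M e ≠ .noop) {n : ℕ}
    {u : IntLattice d} {e : Ev d} (he : e.time ≤ 0) (hk : ∃ i < e.time, M (Ev.mk i u) = .kill)
    (hd : ¬ Determined T (past M) (n + 1) u e) :
    ∃ t : ℕ, ∃ C ∈ T.powerset, ∃ E ∈ (hull C).powerset, ∃ y ∈ hull C, ∃ z ∈ hull C,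
      (Ev.mk (e.time - t) (u - y)).time ≤ 0 ∧
      (M (Ev.mk (e.time - t) (u - y)) = .birth C E ∧ ∀ i, (Ev.mk (e.time - t) (u - y)).time < i →
        i < e.time → M (Ev.mk i u) ≠ .kill) ∧
      ¬ Determined T (past M) n (z + (u - y)) (Ev.mk (e.time - t) (u - y)) := by
  -- Take the latest deletion at `u` before `e`. The failure is then caused by a birth `f` after it,
  -- `t` rounds before `e`, and by maximality no deletion of `u` occurs in the rounds strictly
  -- between `f` and `e`.
  obtain ⟨k, ⟨hk0, hke, hkill⟩, hmax⟩ := Int.exists_greatest_of_bdd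
    (P := fun k => k < 0 ∧ Ev.mk k u < e ∧ M (Ev.mk k u) = .kill) ⟨0, fun k hk => hk.1.le⟩
    (by
      obtain ⟨i, hi, hki⟩ := hk
      exact ⟨i, hi.trans_le he, Ev.lt_of_time_lt hi, hki⟩)
  rw [Determined] at hd
  push Not at hd
  obtain ⟨f, h1, h2, h3, -, h5⟩ := hd k hke (by rwa [past_of_neg _ (by simpa using hk0)])
  rw [past_of_neg _ h3] at h5
  obtain ⟨C, E, hf, hC, hE, hu, z, hz, -, hnd⟩ := h5 (hM f)
  have ht : e.time - ((e.time - f.time).toNat : ℤ) = f.time := by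
    have := Ev.time_le_of_le h2.le
    omega
  refine ⟨(e.time - f.time).toNat, C, Finset.mem_powerset.2 hC, E, Finset.mem_powerset.2 hE,
    u - f.site, hu, z, hz, ?_⟩
  rw [ht, sub_sub_cancel, Ev.mk_eta]
  refine ⟨h3.le, ⟨hf, fun i hi1 hi2 hi => ?_⟩, hnd⟩
  have := hmax i ⟨hi2.trans_le he, Ev.lt_of_time_lt hi2, hi⟩
  have := Ev.time_le_of_le h1.le
  simp at this
  omega

/-- The second moment of the proposals through a site. -/
noncomputable def proposalMoment (T : Finset (NonemptyFinset d)) (r : NonemptyFinset d → ℝ≥0)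
    (g : ℝ≥0) : ℝ≥0 :=
  ∑ C ∈ T.powerset, (∏ A ∈ C, r A) * (1 + g⁻¹) ^ (hull C).card * (hull C).card ^ 2

lemma sum_proposalWeight (C : Finset (NonemptyFinset d)) :
    ∑ E ∈ (hull C).powerset, proposalWeight r g C E =
      (∏ A ∈ C, r A) * g * (1 + g⁻¹) ^ (hull C).card := by
  simp only [proposalWeight]
  rw [← Finset.mul_sum, sum_inv_pow_powerset]

/-- A first-step bound for a subcritical branching search: a union bound over the birth, the
position `y` of `u` in its hull and the next site `z` to be searched. The birth and the missing
deletions involve events from `f` on, the remaining search only events before `f`, so the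
probabilities multiply. Each stage costs at most `2 * g * proposalMoment T r g`. -/
theorem measure_not_determined_le (hm : ∀ e, Measurable (m e)) (hi : iIndepFun m Q)
    (hlaw : ∀ e, Q.map (m e) = markLaw T r g) (hmom : proposalMoment T r g ≤ 1) (n : ℕ)
    (u : IntLattice d) {e : Ev d} (he : e.time ≤ 0) :
    Q {ω | ¬ Determined T (past fun f => m f ω) n u e} ≤ (2 * g) ^ n := by
  induction n generalizing u e with
  | zero => simpa using prob_le_one
  | succ n ih =>
    set q := markLaw T r g {.kill}ᶜ with hq
    set a : ℝ≥0∞ := ENNReal.ofNNReal (killProb T r g) with ha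
    let J : ℕ → Finset (NonemptyFinset d) → Finset (IntLattice d) → IntLattice d → IntLattice d →
        Set Ω := fun t C E y z => {ω | (Ev.mk (e.time - t) (u - y)).time ≤ 0 ∧
      (m (Ev.mk (e.time - t) (u - y)) ω = .birth C E ∧ ∀ i,
        (Ev.mk (e.time - t) (u - y)).time < i → i < e.time → m (Ev.mk i u) ω ≠ .kill) ∧
      ¬ Determined T (past fun f => m f ω) n (z + (u - y)) (Ev.mk (e.time - t) (u - y))}
    have hsub : Q {ω | ¬ Determined T (past fun f => m f ω) (n + 1) u e} ≤
        Q (⋃ t, ⋃ C ∈ T.powerset, ⋃ E ∈ (hull C).powerset, ⋃ y ∈ hull C, ⋃ z ∈ hull C,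
          J t C E y z) := by
      refine measure_mono_ae ?_
      filter_upwards [ae_ne_noop hm hlaw, ae_exists_kill hm hi hlaw u e.time] with ω h1 h2 hω
      obtain ⟨t, C, hC, E, hE, y, hy, z, hz, h⟩ := exists_of_not_determined h1 he h2 hω
      have hmem : ω ∈ ⋃ t, ⋃ C ∈ T.powerset, ⋃ E ∈ (hull C).powerset, ⋃ y ∈ hull C,
          ⋃ z ∈ hull C, J t C E y z := by
        simp only [Set.mem_iUnion]
        exact ⟨t, C, hC, E, hE, y, hy, z, hz, h⟩
      exact hmem
    have hJ : ∀ t, ∀ C ∈ T.powerset, ∀ E ∈ (hull C).powerset, ∀ y z,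
        Q (J t C E y z) ≤ a * proposalWeight r g C E * q ^ (t - 1) * (2 * g) ^ n := by
      intro t C hC E hE y z
      set f := Ev.mk (e.time - t) (u - y) with hf
      by_cases hft : f.time ≤ 0
      swap
      · have : J t C E y z = ∅ := Set.eq_empty_of_forall_notMem fun ω hω => hft hω.1
        simp [this]
      have hind : Q ({ω | m f ω = .birth C E ∧ ∀ i, f.time < i → i < e.time →
          m (Ev.mk i u) ω ≠ .kill} ∩
          {ω | ¬ Determined T (past fun f => m f ω) n (z + (u - y)) f}) =
          Q {ω | m f ω = .birth C E ∧ ∀ i, f.time < i → i < e.time → m (Ev.mk i u) ω ≠ .kill} *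
          Q {ω | ¬ Determined T (past fun f => m f ω) n (z + (u - y)) f} := by
        refine (Indep_iff _ _ _).1 (indep_blockAlgebra hm hi (D := Set.Ici f) (D' := Set.Iio f) ?_)
          _ _ ?_ (measurableSet_not_determined n _ f)
        · exact Set.disjoint_left.2 fun x h1 h2 => (Set.mem_Ici.1 h1).not_gt (Set.mem_Iio.1 h2)
        · refine MeasurableSet.inter (measurable_blockAlgebra_of_mem (D := Set.Ici f)
            (Set.mem_Ici.2 le_rfl) (MeasurableSet.of_discrete (s := {Mark.birth C E}))) ?_
          have : {ω | ∀ i, f.time < i → i < e.time → m (Ev.mk i u) ω ≠ .kill} =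
              ⋂ i, ⋂ (_ : f.time < i), ⋂ (_ : i < e.time), m (Ev.mk i u) ⁻¹' {.kill}ᶜ := by
            ext ω; simp
          change MeasurableSet[blockAlgebra m (Set.Ici f)]
            {ω | ∀ i, f.time < i → i < e.time → m (Ev.mk i u) ω ≠ .kill}
          rw [this]
          refine MeasurableSet.iInter fun i => MeasurableSet.iInter fun hi' =>
            MeasurableSet.iInter fun _ => measurable_blockAlgebra_of_mem (D := Set.Ici f) ?_
              MeasurableSet.of_discrete
          exact (Ev.lt_of_time_lt hi').le
      calc Q (J t C E y z) ≤ Q ({ω | m f ω = .birth C E ∧ ∀ i, f.time < i → i < e.time →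
                m (Ev.mk i u) ω ≠ .kill} ∩
              {ω | ¬ Determined T (past fun f => m f ω) n (z + (u - y)) f}) :=
            measure_mono fun ω hω => ⟨hω.2.1, hω.2.2⟩
        _ ≤ _ := by
          rw [hind, measure_birth_inter_noKill hm hi hlaw, markLaw_birth T r g
            (Finset.mem_powerset.1 hC) (Finset.mem_powerset.1 hE)]
          refine mul_le_mul' (mul_le_mul' le_rfl (le_of_eq ?_)) (ih _ hft)
          congr 1
          simp [hf]
    have ha1 : a ≤ 1 := ENNReal.coe_le_one_iff.2 killProb_le_one
    -- Truncated subtraction is intended: for `t = 0` and for `t = 1` no round lies strictly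
    -- between, so both terms are `1`. The total is `a + a * a⁻¹ = a + 1`.
    have hgeom : a * ∑' t : ℕ, q ^ (t - 1) ≤ 2 := by
      rw [tsum_eq_zero_add' ENNReal.summable]
      simp only [zero_tsub, pow_zero, add_tsub_cancel_right]
      rw [ENNReal.tsum_geometric, hq, markLaw_compl_kill, ENNReal.sub_sub_cancel
        ENNReal.one_ne_top ha1, mul_add, mul_one, ENNReal.mul_inv_cancel
        (by exact_mod_cast killProb_pos.ne') ENNReal.coe_ne_top, ← one_add_one_eq_two]
      exact add_le_add_left ha1 1
    calc Q {ω | ¬ Determined T (past fun f => m f ω) (n + 1) u e}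
        ≤ ∑' t, ∑ C ∈ T.powerset, ∑ E ∈ (hull C).powerset, ∑ y ∈ hull C, ∑ z ∈ hull C,
            a * proposalWeight r g C E * q ^ (t - 1) * (2 * g) ^ n := by
          refine hsub.trans ((measure_iUnion_le _).trans (ENNReal.tsum_le_tsum fun t => ?_))
          refine (measure_biUnion_finset_le _ _).trans (Finset.sum_le_sum fun C hC => ?_)
          refine (measure_biUnion_finset_le _ _).trans (Finset.sum_le_sum fun E hE => ?_)
          refine (measure_biUnion_finset_le _ _).trans (Finset.sum_le_sum fun y hy => ?_)
          refine (measure_biUnion_finset_le _ _).trans (Finset.sum_le_sum fun z hz => ?_)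
          exact hJ t C hC E hE y z
      -- The sums over `y` and `z` give the squared size of the hull, the sum over `E` gives the
      -- power of `1 + g⁻¹`. The empty collection drops out, its hull being empty.
      _ = ∑' t, q ^ (t - 1) * (a * (2 * g) ^ n * (g * proposalMoment T r g : ℝ≥0)) := by
          congr 1
          funext t
          simp only [Finset.sum_const, nsmul_eq_mul, proposalMoment]
          push_cast
          simp only [Finset.mul_sum]
          refine Finset.sum_congr rfl fun C hC => ?_
          have h := congrArg (fun x : ℝ≥0 => (x : ℝ≥0∞)) (sum_proposalWeight (r := r) (g := g) C)
          push_cast at h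
          simp only [← Finset.mul_sum, ← Finset.sum_mul]
          rw [h]
          ring
      _ ≤ (2 * g) ^ (n + 1) := by
          rw [ENNReal.tsum_mul_right]
          calc (∑' t, q ^ (t - 1)) * (a * (2 * g) ^ n * (g * proposalMoment T r g : ℝ≥0))
              = (a * ∑' t, q ^ (t - 1)) * ((g * proposalMoment T r g : ℝ≥0) * (2 * g) ^ n) := by
                ring
            _ ≤ 2 * ((g : ℝ≥0) * (2 * g) ^ n) := by
                gcongr
                exact mul_le_of_le_one_right zero_le hmom
            _ = (2 * g) ^ (n + 1) := by ring

theorem ae_determined (hm : ∀ e, Measurable (m e)) (hi : iIndepFun m Q)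
    (hlaw : ∀ e, Q.map (m e) = markLaw T r g) (hmom : proposalMoment T r g ≤ 1)
    (hg : 2 * g < 1) :
    ∀ᵐ ω ∂Q, ∀ u, ∃ n, Determined T (past fun f => m f ω) n u (Ev.final d) := by
  rw [ae_all_iff]
  intro u
  rw [ae_iff]
  have hlt : (2 * g : ℝ≥0∞) < 1 := by exact_mod_cast hg
  refine le_antisymm (ge_of_tendsto' (ENNReal.tendsto_pow_atTop_nhds_zero_of_lt_one hlt)
    fun n => ?_) zero_le
  refine (measure_mono fun ω hω => ?_).trans
    (measure_not_determined_le hm hi hlaw hmom n u (e := Ev.final d) le_rfl)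
  exact fun h => hω ⟨n, h⟩

end RandomMarks

section LimitLaw

open scoped NNReal ENNReal
open Classical

variable {d : ℕ} {T : Finset (NonemptyFinset d)} {r : NonemptyFinset d → ℝ≥0} {g : ℝ≥0}

/-- Expand the product over `V` of `g` (on) plus the weight of off, which is `0` on `h` and `1`
elsewhere. -/
lemma sum_superset_pow (V h : Finset (IntLattice d)) (hh : h ⊆ V) :
    ∑ b ∈ V.powerset with h ⊆ b, g ^ b.card = g ^ h.card * (1 + g) ^ (V \ h).card := by
  have key := Finset.prod_add (fun _ => g) (fun v => if v ∈ h then 0 else (1 : ℝ≥0)) V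
  have h1 : ∏ v ∈ V, (g + if v ∈ h then 0 else (1 : ℝ≥0)) =
      g ^ h.card * (1 + g) ^ (V \ h).card := by
    rw [← Finset.prod_sdiff hh, mul_comm]
    congr 1
    · rw [Finset.prod_congr rfl (g := fun _ => g) fun v hv => by simp [hv], Finset.prod_const]
    · rw [Finset.prod_congr rfl (g := fun _ => 1 + g) fun v hv => by
        simp [(Finset.mem_sdiff.1 hv).2, add_comm], Finset.prod_const]
  rw [← h1, key, Finset.sum_filter]
  refine Finset.sum_congr rfl fun b _ => ?_
  rw [Finset.prod_const]
  split_ifs with hb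
  · rw [Finset.prod_eq_one, mul_one]
    exact fun v hv => if_neg fun hvh => (Finset.mem_sdiff.1 hv).2 (hb hvh)
  · obtain ⟨v, hv, hvb⟩ := Finset.not_subset.1 hb
    have : ∏ v ∈ V \ b, (if v ∈ h then 0 else (1 : ℝ≥0)) = 0 :=
      Finset.prod_eq_zero (Finset.mem_sdiff.2 ⟨hh hv, hvb⟩) (if_pos hv)
    rw [this, mul_zero]

/-- The selected sets are independent under the stationary weights. -/
lemma sum_stateWeight_prod (hg : g ≠ 0) (V : Finset (IntLattice d))
    (F : NonemptyFinset d → Bool → ℝ≥0) :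
    ∑ s ∈ statesIn T V, stateWeight r g s * ∏ A ∈ classIn T V, F A (decide (A ∈ s.1)) =
      (1 + g) ^ V.card * ∏ A ∈ classIn T V, (r A * F A true + F A false) := by
  have h1 : ∀ x ∈ (classIn T V).powerset,
      ∑ b ∈ V.powerset with hull x ⊆ b, stateWeight r g (x, b) *
        ∏ A ∈ classIn T V, F A (decide (A ∈ x)) =
      (1 + g) ^ V.card * ((∏ A ∈ x, r A * F A true) * ∏ A ∈ classIn T V \ x, F A false) := by
    intro x hx
    rw [Finset.mem_powerset] at hx
    have hxV : hull x ⊆ V := fun u hu => by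
      obtain ⟨A, hA, hu⟩ := mem_hull.1 hu
      exact (mem_classIn.1 (hx hA)).1 hu
    have h2 : ∏ A ∈ classIn T V, F A (decide (A ∈ x)) =
        (∏ A ∈ x, F A true) * ∏ A ∈ classIn T V \ x, F A false := by
      rw [← Finset.prod_sdiff hx, mul_comm]
      congr 1
      · exact Finset.prod_congr rfl fun A hA => by simp [hA]
      · exact Finset.prod_congr rfl fun A hA => by simp [(Finset.mem_sdiff.1 hA).2]
    -- A covered site weighs as much as an uncovered site summed over on and off, so the dependence
    -- on `hull x` cancels.
    have h3 : g ^ (hull x).card * (1 + g⁻¹) ^ (hull x).card = (1 + g) ^ (hull x).card := by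
      rw [← mul_pow, mul_add, mul_one, mul_inv_cancel₀ hg, add_comm]
    have h4 : (1 + g) ^ V.card = (1 + g) ^ (hull x).card * (1 + g) ^ (V \ hull x).card := by
      rw [← pow_add, add_comm (hull x).card, Finset.card_sdiff_add_card_eq_card hxV]
    rw [← Finset.sum_mul]
    simp only [stateWeight]
    rw [← Finset.sum_mul, ← Finset.mul_sum, sum_superset_pow V _ hxV, h2, h4, ← h3,
      Finset.prod_mul_distrib]
    ring
  rw [Finset.prod_add, Finset.mul_sum, ← Finset.sum_congr rfl h1]
  simp only [statesIn]
  rw [Finset.sum_filter, Finset.sum_product]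
  simp only [Finset.sum_filter]

/-- The mass of a set of truth values under a Bernoulli law with odds `r`. -/
noncomputable def bernMass (r : ℝ≥0) (t : Set Bool) : ℝ≥0 :=
  (if true ∈ t then r / (1 + r) else 0) + if false ∈ t then 1 / (1 + r) else 0

lemma sum_stateWeight_indicator (hg : g ≠ 0) (V : Finset (IntLattice d))
    {𝒜 : Finset (NonemptyFinset d)} (h𝒜 : 𝒜 ⊆ classIn T V) (t : NonemptyFinset d → Set Bool) :
    ∑ s ∈ statesIn T V, stateWeight r g s *
        (if ∀ A ∈ 𝒜, decide (A ∈ s.1) ∈ t A then 1 else 0) =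
      (∑ s ∈ statesIn T V, stateWeight r g s) * ∏ A ∈ 𝒜, bernMass (r A) (t A) := by
  have h1 := sum_stateWeight_prod (T := T) (r := r) hg V
    fun A b => if A ∈ 𝒜 ∧ b ∉ t A then 0 else 1
  have h2 := sum_stateWeight_prod (T := T) (r := r) hg V fun _ _ => 1
  simp only [Finset.prod_const_one, mul_one] at h2
  rw [h2]
  have h3 : ∀ s : DynState d, (if ∀ A ∈ 𝒜, decide (A ∈ s.1) ∈ t A then 1 else 0 : ℝ≥0) =
      ∏ A ∈ classIn T V, if A ∈ 𝒜 ∧ decide (A ∈ s.1) ∉ t A then 0 else 1 := by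
    intro s
    split_ifs with h
    · exact (Finset.prod_eq_one fun A _ => if_neg fun h' => h'.2 (h A h'.1)).symm
    · push Not at h
      obtain ⟨A, hA, h⟩ := h
      symm
      refine Finset.prod_eq_zero (i := A) (h𝒜 hA) ?_
      rw [if_pos ⟨hA, h⟩]
  simp only [h3]
  rw [h1, mul_assoc]
  congr 1
  have h4 : ∏ A ∈ 𝒜, bernMass (r A) (t A) =
      ∏ A ∈ classIn T V, if A ∈ 𝒜 then bernMass (r A) (t A) else 1 := by
    rw [← Finset.prod_filter]
    congr 1
    ext A
    simpa using fun hA => h𝒜 hA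
  rw [h4, ← Finset.prod_mul_distrib]
  refine Finset.prod_congr rfl fun A _ => ?_
  have h5 : r A + 1 ≠ 0 := by positivity
  by_cases hA : A ∈ 𝒜
  · simp only [hA, true_and, if_true, bernMass, add_comm (1 : ℝ≥0)]
    by_cases ht : true ∈ t A <;> by_cases hf : false ∈ t A <;>
      simp [ht, hf, mul_add, mul_div_cancel₀ _ h5]
  · simp [hA]

variable {Ω : Type*} [MeasurableSpace Ω] {Q : Measure Ω} [IsProbabilityMeasure Q]
  {m : Ev d → Ω → Mark d}

/-- The limiting selected sets are independent, with the prescribed probabilities. -/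
theorem measure_limitSets (hm : ∀ e, Measurable (m e)) (hi : iIndepFun m Q)
    (hlaw : ∀ e, Q.map (m e) = markLaw T r g) (hT0 : ∀ A ∈ T, 0 ∈ A.1)
    (hT : ∀ A ∈ T, ∀ u ∈ A.1, A.translate (-u) ∈ T)
    (hr : ∀ (A : NonemptyFinset d) (v : IntLattice d), r (A.translate v) = r A) (hg : g ≠ 0)
    (hdet : ∀ᵐ ω ∂Q, ∀ u, ∃ n, Determined T (past fun f => m f ω) n u (Ev.final d))
    {𝒜 : Finset (NonemptyFinset d)} (h𝒜 : ∀ A ∈ 𝒜, ∀ u ∈ A.1, A.translate (-u) ∈ T)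
    (t : NonemptyFinset d → Set Bool) :
    Q {ω | ∀ A ∈ 𝒜, decide (A ∈ limitSets T (past fun f => m f ω)) ∈ t A} =
      ∏ A ∈ 𝒜, (bernMass (r A) (t A) : ℝ≥0∞) := by
  set E := {ω | ∀ A ∈ 𝒜, decide (A ∈ limitSets T (past fun f => m f ω)) ∈ t A} with hE
  set β : ℝ≥0∞ := ∏ A ∈ 𝒜, (bernMass (r A) (t A) : ℝ≥0∞) with hβ
  let V : ℕ → Finset (IntLattice d) := fun n => Finset.Icc (fun _ => -(n : ℤ)) fun _ => (n : ℤ)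
  -- On `G n` the window of size `n` certifies the status of every `A ∈ 𝒜`, whatever the initial
  -- state; one site of `A` suffices.
  let G : ℕ → Set Ω := fun n => {ω | ∀ A ∈ 𝒜, ∃ u ∈ A.1, ∃ l,
    Determined T (restrictTo (win d n) (past fun f => m f ω)) l u (Ev.final d)}
  have hmm : Measurable fun ω e => m e ω := measurable_pi_lambda _ hm
  have hGmeas : ∀ n, MeasurableSet (G n) := fun n => by
    refine measurableSet_setOfPred.2 ?_
    refine Measurable.forall fun A => measurable_const.imp (Measurable.exists fun u =>
      measurable_const.and (Measurable.exists fun l => ?_))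
    exact (measurable_determined l u _).comp ((measurable_restrictTo _).comp
      (measurable_past.comp hmm))
  have hGanti : Antitone fun n => (G n)ᶜ := fun n n' hn => by
    refine Set.compl_subset_compl.2 fun ω hω A hA => ?_
    obtain ⟨u, hu, l, h⟩ := hω A hA
    exact ⟨u, hu, l, h.mono (restrictTo_extends (win_mono hn) _) le_rfl⟩
  have hGlim : Filter.Tendsto (fun n => Q (G n)ᶜ) Filter.atTop (nhds 0) := by
    have h0 : Q (⋂ n, (G n)ᶜ) = 0 := by
      rw [measure_eq_zero_iff_ae_notMem]
      filter_upwards [hdet] with ω hω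
      have h1 : ∀ A ∈ 𝒜, ∀ᶠ n in Filter.atTop, ∃ u ∈ A.1, ∃ l,
          Determined T (restrictTo (win d n) (past fun f => m f ω)) l u (Ev.final d) := by
        intro A _
        obtain ⟨u, hu⟩ := A.2
        obtain ⟨l, hl⟩ := hω u
        filter_upwards [hl.eventually_restrictTo fun e he => past_of_nonneg _ he] with n hn
        exact ⟨u, hu, l, hn⟩
      obtain ⟨n, hn⟩ := ((Filter.eventually_all_finset 𝒜).2 h1).exists
      intro hmem
      exact Set.mem_iInter.1 hmem n hn
    rw [← h0]
    exact tendsto_measure_iInter_atTop (fun n => (hGmeas n).compl.nullMeasurableSet) hGanti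
      ⟨0, measure_ne_top _ _⟩
  -- comparison with the stationary run in a finite window
  have hcomp : ∀ n, ∀ s ∈ statesIn T (V n), ∀ ω ∈ G n,
      (ω ∈ E ↔ ∀ A ∈ 𝒜, decide (A ∈ (run T (win d n) (fun e => m e ω) s).1) ∈ t A) := by
    intro n s hs ω hω
    refine forall₂_congr fun A hA => ?_
    obtain ⟨u, hu, l, h⟩ := hω A hA
    have h1 := h.mem_limitSets_iff hT0 hT (fun e he => past_of_nonneg _ he)
      (extends_restrictTo _ _) (fun e he => past_of_nonneg _ he) subset_rfl
      (InClass.of_mem_statesIn hs) hu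
    have h2 : run T (win d n) (past fun e => m e ω) s = run T (win d n) (fun e => m e ω) s :=
      run_congr (fun e he => past_of_neg _ (mem_win.1 he).1.2) s
    rw [h2] at h1
    simp only [h1]
  let E' : ℕ → DynState d → Set Ω := fun n s =>
    {ω | ∀ A ∈ 𝒜, decide (A ∈ (run T (win d n) (fun e => m e ω) s).1) ∈ t A}
  have hE' : ∀ n s, ∫⁻ ω, (if ∀ A ∈ 𝒜, decide (A ∈ (run T (win d n) (fun e => m e ω) s).1) ∈ t A
      then 1 else 0) ∂Q = Q (E' n s) := by
    intro n s
    have hmeas : MeasurableSet (E' n s) := by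
      have : MeasurableSet {s' : DynState d | ∀ A ∈ 𝒜, decide (A ∈ s'.1) ∈ t A} :=
        MeasurableSet.of_discrete
      exact ((measurable_run (win d n) s).comp hmm) this
    rw [← lintegral_indicator_one hmeas]
    refine lintegral_congr fun ω => ?_
    simp only [Set.indicator_apply, E', Pi.one_apply]
    rfl
  have hsum : ∀ᶠ n in Filter.atTop, ∑ s ∈ statesIn T (V n), stateWeight r g s * Q (E' n s) =
      (∑ s ∈ statesIn T (V n), (stateWeight r g s : ℝ≥0∞)) * β := by
    have h1 : ∀ᶠ n in Filter.atTop, 𝒜 ⊆ classIn T (V n) := by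
      refine (Filter.eventually_all_finset 𝒜).2 fun A hA => ?_
      have h2 : ∀ u ∈ A.1, ∀ᶠ n in Filter.atTop, u ∈ V n := fun u _ => by
        filter_upwards [eventually_mem_win (e := Ev.mk (-1) u) (by simp)] with n hn
        exact norm_le_iff.1 (mem_win.1 hn).2
      filter_upwards [(Filter.eventually_all_finset A.1).2 h2] with n hn
      exact mem_classIn.2 ⟨hn, h𝒜 A hA⟩
    filter_upwards [h1] with n hn
    have h3 := sum_stateWeight_run (r := r) (g := g) hm hi hlaw hT0 hT hr (V := V n)
      (W := win d n) (fun e he => norm_le_iff.1 (mem_win.1 he).2)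
      (fun s => if ∀ A ∈ 𝒜, decide (A ∈ s.1) ∈ t A then 1 else 0)
    simp only [hE'] at h3
    rw [h3]
    have h4 := congrArg (fun x : ℝ≥0 => (x : ℝ≥0∞))
      (sum_stateWeight_indicator (r := r) hg (V n) hn t)
    push_cast at h4
    rw [hβ, ← h4]
    refine Finset.sum_congr rfl fun s _ => ?_
    split_ifs <;> simp
  have hZ : ∀ n, (∑ s ∈ statesIn T (V n), (stateWeight r g s : ℝ≥0∞)) ≠ 0 ∧
      (∑ s ∈ statesIn T (V n), (stateWeight r g s : ℝ≥0∞)) ≠ ⊤ := by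
    intro n
    refine ⟨?_, by simp⟩
    have h2 := sum_stateWeight_prod (T := T) (r := r) hg (V n) fun _ _ => 1
    simp only [Finset.prod_const_one, mul_one] at h2
    rw [← ENNReal.ofNNReal_finsetSum, h2]
    have : (1 + g) ^ (V n).card * ∏ A ∈ classIn T (V n), (r A + 1) ≠ 0 := by positivity
    exact_mod_cast this
  -- Averaged over stationary initial states, `E' n s` has probability exactly `β`, and each `E' n
  -- s` differs from `E` only off `G n`.
  have hle1 : ∀ᶠ n in Filter.atTop, Q E ≤ β + Q (G n)ᶜ := by
    filter_upwards [hsum] with n hn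
    refine (ENNReal.mul_le_mul_iff_right (hZ n).1 (hZ n).2).1 ?_
    rw [mul_add, ← hn, Finset.sum_mul, Finset.sum_mul, ← Finset.sum_add_distrib]
    refine Finset.sum_le_sum fun s hs => ?_
    rw [← mul_add]
    gcongr
    refine (measure_mono fun ω hω => ?_).trans (measure_union_le _ _)
    by_cases hG : ω ∈ G n
    · exact Or.inl ((hcomp n s hs ω hG).1 hω)
    · exact Or.inr hG
  have hle2 : ∀ᶠ n in Filter.atTop, β ≤ Q E + Q (G n)ᶜ := by
    filter_upwards [hsum] with n hn
    refine (ENNReal.mul_le_mul_iff_right (hZ n).1 (hZ n).2).1 ?_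
    rw [mul_add, ← hn, Finset.sum_mul, Finset.sum_mul, ← Finset.sum_add_distrib]
    refine Finset.sum_le_sum fun s hs => ?_
    rw [← mul_add]
    gcongr
    refine (measure_mono fun ω hω => ?_).trans (measure_union_le _ _)
    by_cases hG : ω ∈ G n
    · exact Or.inl ((hcomp n s hs ω hG).2 hω)
    · exact Or.inr hG
  refine le_antisymm ?_ ?_
  · have := hGlim.const_add β
    rw [add_zero] at this
    exact ge_of_tendsto this hle1
  · have := hGlim.const_add (Q E)
    rw [add_zero] at this
    exact ge_of_tendsto this hle2

end LimitLaw

section Levels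

open scoped NNReal ENNReal

variable {d : ℕ}

lemma sq_le_four_pow (n : ℕ) : (n : ℝ≥0) ^ 2 ≤ 4 ^ n := by
  have h : n ≤ 2 ^ n := Nat.lt_two_pow_self.le
  have h2 : n ^ 2 ≤ 4 ^ n := by
    calc n ^ 2 ≤ (2 ^ n) ^ 2 := Nat.pow_le_pow_left h 2
      _ = 4 ^ n := by rw [← pow_mul, mul_comm, pow_mul]; norm_num
  exact_mod_cast h2

lemma prod_one_add_le_two {ι : Type*} (s : Finset ι) (x : ι → ℝ≥0) (h : ∑ i ∈ s, x i ≤ 1 / 4) :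
    ∏ i ∈ s, (1 + x i) ≤ 2 := by
  have h1 : ∏ i ∈ s, (1 + (x i : ℝ)) ≤ Real.exp (∑ i ∈ s, (x i : ℝ)) := by
    rw [Real.exp_sum]
    refine Finset.prod_le_prod (fun i _ => by positivity) fun i _ => ?_
    rw [add_comm]
    exact Real.add_one_le_exp _
  have h2 : ∑ i ∈ s, (x i : ℝ) ≤ Real.log 2 := by
    have : ∑ i ∈ s, (x i : ℝ) ≤ 1 / 4 := by exact_mod_cast h
    have := Real.log_two_gt_d9
    linarith
  have h3 := h1.trans (Real.exp_le_exp.2 h2)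
  rw [Real.exp_log two_pos] at h3
  exact_mod_cast h3

variable {T : Finset (NonemptyFinset d)} {r : NonemptyFinset d → ℝ≥0} {g : ℝ≥0}

/-- The hull has at most as many points as its members together, so the sum is dominated by the
product of `1 + r A * b ^ A.1.card`. -/
lemma sum_powerset_hull_le (b : ℝ≥0) (hb : 1 ≤ b) (h : ∑ A ∈ T, r A * b ^ A.1.card ≤ 1 / 4) :
    ∑ C ∈ T.powerset, (∏ A ∈ C, r A) * b ^ (hull C).card ≤ 2 := by
  refine le_trans ?_ (prod_one_add_le_two T _ h)
  rw [Finset.prod_one_add]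
  refine Finset.sum_le_sum fun C _ => ?_
  rw [Finset.prod_mul_distrib, Finset.prod_pow_eq_pow_sum]
  exact mul_le_mul' le_rfl (pow_le_pow_right₀ hb Finset.card_biUnion_le)

/-- The base `4` absorbs the squared size of the hull. The empty collection has no moment but takes
`1` of the bound `2`, which leaves `1`. -/
lemma proposalMoment_le_one (h : ∑ A ∈ T, r A * (4 * (1 + g⁻¹)) ^ A.1.card ≤ 1 / 4) :
    proposalMoment T r g ≤ 1 := by
  have h1 : (1 : ℝ≥0) ≤ 4 * (1 + g⁻¹) :=
    (by norm_num : (1 : ℝ≥0) ≤ 4 * 1).trans (by gcongr; exact le_add_of_nonneg_right zero_le)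
  have h2 := sum_powerset_hull_le _ h1 h
  have h3 : proposalMoment T r g + 1 ≤
      ∑ C ∈ T.powerset, (∏ A ∈ C, r A) * (4 * (1 + g⁻¹)) ^ (hull C).card := by
    have h4 : ∑ C ∈ T.powerset, (if C = ∅ then 1 else 0 : ℝ≥0) = 1 := by
      rw [Finset.sum_ite_eq']
      simp
    rw [proposalMoment, ← h4, ← Finset.sum_add_distrib]
    refine Finset.sum_le_sum fun C _ => ?_
    by_cases hC : C = ∅
    · simp [hC, hull]
    · rw [if_neg hC, add_zero, mul_assoc, mul_pow, mul_comm ((4 : ℝ≥0) ^ _)]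
      exact mul_le_mul' le_rfl (mul_le_mul' le_rfl (sq_le_four_pow _))
  have h5 : proposalMoment T r g + 1 ≤ 1 + 1 := by
    rw [one_add_one_eq_two]; exact h3.trans h2
  exact le_of_add_le_add_right h5

lemma proposalMass_le (h : ∑ A ∈ T, r A * (4 * (1 + g⁻¹)) ^ A.1.card ≤ 1 / 4) :
    proposalMass T r g ≤ 2 * g := by
  have h1 : (1 : ℝ≥0) ≤ 4 * (1 + g⁻¹) :=
    (by norm_num : (1 : ℝ≥0) ≤ 4 * 1).trans (by gcongr; exact le_add_of_nonneg_right zero_le)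
  have h2 := sum_powerset_hull_le _ h1 h
  refine le_trans ?_ (mul_le_mul_left h2 g)
  rw [proposalMass, Finset.sum_mul]
  refine Finset.sum_le_sum fun C _ => ?_
  rw [sum_proposalWeight, mul_right_comm]
  gcongr
  exact le_mul_of_one_le_left zero_le (by norm_num)

/-- The differences of the members of `A` have norm at most `n`. -/
def SpreadLE (n : ℕ) (A : NonemptyFinset d) : Prop := ∀ u ∈ A.1, ∀ v ∈ A.1, ‖u - v‖ ≤ (n : ℝ)

lemma spreadLE_translate {n : ℕ} {A : NonemptyFinset d} {v : IntLattice d} :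
    SpreadLE n (A.translate v) ↔ SpreadLE n A := by
  unfold SpreadLE
  constructor
  · intro h x hx y hy
    simpa using h (x + v) (by simpa using hx) (y + v) (by simpa using hy)
  · intro h x hx y hy
    simpa using h (x - v) (by simpa using hx) (y - v) (by simpa using hy)

lemma SpreadLE.mono {n m : ℕ} (h : n ≤ m) {A : NonemptyFinset d} (hA : SpreadLE n A) :
    SpreadLE m A := fun u hu v hv => (hA u hu v hv).trans (by exact_mod_cast h)

lemma exists_spreadLE (A : NonemptyFinset d) : ∃ n, SpreadLE n A := by
  have h : ∀ u ∈ A.1, ∀ v ∈ A.1, ∀ᶠ n : ℕ in Filter.atTop, ‖u - v‖ ≤ (n : ℝ) := fun u _ v _ =>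
    tendsto_natCast_atTop_atTop.eventually_ge_atTop ‖u - v‖
  exact ((Filter.eventually_all_finset A.1).2 fun u hu =>
    (Filter.eventually_all_finset A.1).2 (h u hu)).exists

lemma finite_spreadLE (n : ℕ) :
    {A : NonemptyFinset d | (0 : IntLattice d) ∈ A.1 ∧ SpreadLE n A}.Finite := by
  refine Set.Finite.of_finite_image (f := Subtype.val) ?_ Subtype.val_injective.injOn
  refine Set.Finite.subset ((Finset.Icc (fun _ : Fin d => -(n : ℤ))
    fun _ => (n : ℤ)).powerset.finite_toSet) ?_
  rintro _ ⟨A, ⟨h0, hA⟩, rfl⟩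
  refine Finset.mem_coe.2 (Finset.mem_powerset.2 fun u hu => norm_le_iff.1 ?_)
  simpa using hA u hu 0 h0

/-- The odds of the selection probabilities. -/
noncomputable def odds (p : NonemptyFinset d → ℝ) (A : NonemptyFinset d) : ℝ≥0 :=
  Real.toNNReal (p A / (1 - p A))

/-- The density parameters of the levels. -/
noncomputable def gap (k : ℕ) : ℝ≥0 := 1 / 8 * (1 / 2) ^ k

lemma gap_ne_zero (k : ℕ) : gap k ≠ 0 := by unfold gap; positivity

lemma two_mul_gap_lt_one (k : ℕ) : 2 * gap k < 1 := by
  have h : (1 / 2 : ℝ≥0) ^ k ≤ 1 := pow_le_one₀ zero_le (by norm_num)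
  calc 2 * gap k = 1 / 4 * (1 / 2) ^ k := by unfold gap; ring
    _ ≤ 1 / 4 * 1 := by gcongr
    _ < 1 := by norm_num

/-- The exponential moment with `l = log b`, where `b = 4 * (1 + g⁻¹)`, has a small tail outside a
finite family, and a large spread excludes that family. As `g` tends to `0` over the levels, all
exponential moments are used. A tail of `1 / 8` also forces `p A ≤ 1 / 8`, so that the odds are at
most `2 * p A`. -/
lemma exists_spread_sum_le {p : NonemptyFinset d → ℝ} (h0 : ∀ A, 0 ≤ p A)
    (hexp : ∀ l : ℝ, 0 < l →
      Summable fun A : OriginFinset d => p A.1 * Real.exp (l * (A.1.1.card : ℝ))) (g : ℝ≥0) :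
    ∃ N : ℕ, ∀ S : Finset (NonemptyFinset d),
      (∀ A ∈ S, (0 : IntLattice d) ∈ A.1 ∧ ¬ SpreadLE N A) →
        ∑ A ∈ S, odds p A * (4 * (1 + g⁻¹)) ^ A.1.card ≤ 1 / 4 := by
  set b : ℝ≥0 := 4 * (1 + g⁻¹) with hb
  have hb1 : (1 : ℝ) < b := by
    rw [hb]
    push_cast
    have : (0 : ℝ) ≤ (g : ℝ)⁻¹ := by positivity
    linarith
  have hsum := hexp (Real.log b) (Real.log_pos hb1)
  have hpow : ∀ n : ℕ, Real.exp (Real.log b * n) = (b : ℝ) ^ n := fun n => by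
    rw [mul_comm, Real.exp_nat_mul, Real.exp_log (by linarith)]
  simp only [hpow] at hsum
  obtain ⟨F, hF⟩ := summable_iff_vanishing_norm.1 hsum (1 / 8) (by norm_num)
  choose n hn using exists_spreadLE (d := d)
  refine ⟨F.sup fun A => n A.1, fun S hS => ?_⟩
  have hSF : ∀ A (hA : A ∈ S), (⟨A, (hS A hA).1⟩ : OriginFinset d) ∉ F := fun A hA hAF =>
    (hS A hA).2 ((hn A).mono (Finset.le_sup (f := fun A : OriginFinset d => n A.1) hAF))
  have hle : ∀ S' : Finset (NonemptyFinset d), S' ⊆ S →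
      ∑ A ∈ S', p A * (b : ℝ) ^ A.1.card ≤ 1 / 8 := by
    intro S' hS'
    have h1 := hF (S'.subtype fun A => (0 : IntLattice d) ∈ A.1) (by
      rw [Finset.disjoint_left]
      intro A hA hAF
      exact hSF A.1 (hS' (Finset.mem_subtype.1 hA)) hAF)
    have h2 : ∑ A ∈ S'.subtype fun A => (0 : IntLattice d) ∈ A.1, p A.1 * (b : ℝ) ^ A.1.1.card =
        ∑ A ∈ S', p A * (b : ℝ) ^ A.1.card :=
      Finset.sum_subtype_of_mem (fun A => p A * (b : ℝ) ^ A.1.card) fun A hA => (hS A (hS' hA)).1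
    rw [h2] at h1
    exact (le_abs_self _).trans h1.le
  have hp : ∀ A ∈ S, p A ≤ 1 / 8 := by
    intro A hA
    have h1 := hle {A} (by simpa using hA)
    rw [Finset.sum_singleton] at h1
    exact (le_mul_of_one_le_right (h0 A) (one_le_pow₀ hb1.le)).trans h1
  have hodds : ∀ A ∈ S, (odds p A : ℝ) ≤ 2 * p A := by
    intro A hA
    have h1 := hp A hA
    have h2 := h0 A
    rw [odds, Real.coe_toNNReal _ (div_nonneg h2 (by linarith)), div_le_iff₀ (by linarith)]
    nlinarith
  have hreal : ∑ A ∈ S, (odds p A : ℝ) * (b : ℝ) ^ A.1.card ≤ 1 / 4 := by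
    calc ∑ A ∈ S, (odds p A : ℝ) * (b : ℝ) ^ A.1.card
        ≤ ∑ A ∈ S, 2 * (p A * (b : ℝ) ^ A.1.card) := by
          refine Finset.sum_le_sum fun A hA => ?_
          rw [← mul_assoc]
          gcongr
          exact hodds A hA
      _ ≤ 1 / 4 := by
          rw [← Finset.mul_sum]
          linarith [hle S subset_rfl]
  exact_mod_cast hreal

/-- The finite sets can be divided into translation invariant levels, with finitely many sets
through the origin on each level, such that the proposals of the levels are rare. -/
theorem exists_level {p : NonemptyFinset d → ℝ} (h0 : ∀ A, 0 ≤ p A)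
    (hexp : ∀ l : ℝ, 0 < l →
      Summable fun A : OriginFinset d => p A.1 * Real.exp (l * (A.1.1.card : ℝ))) :
    ∃ (level : NonemptyFinset d → ℕ) (T : ℕ → Finset (NonemptyFinset d)),
      (∀ A v, level (A.translate v) = level A) ∧
      (∀ k A, A ∈ T k ↔ (0 : IntLattice d) ∈ A.1 ∧ level A = k) ∧
      (∀ k, proposalMoment (T (k + 1)) (odds p) (gap k) ≤ 1) ∧
      ∀ k, proposalMass (T (k + 1)) (odds p) (gap k) ≤ 2 * gap k := by
  classical
  choose N hN using fun k => exists_spread_sum_le h0 hexp (gap k)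
  -- The term `N k` makes the sets beyond level `k` rare enough for level `k + 1`; the term `k`
  -- ensures that every set receives a level.
  have hex : ∀ A : NonemptyFinset d, ∃ k, SpreadLE (max (N k) k) A := fun A => by
    obtain ⟨n, hn⟩ := exists_spreadLE A
    exact ⟨n, hn.mono (le_max_right _ _)⟩
  have hfin : ∀ k, {A : NonemptyFinset d | (0 : IntLattice d) ∈ A.1 ∧
      Nat.find (hex A) = k}.Finite := fun k =>
    (finite_spreadLE (max (N k) k)).subset fun A hA => ⟨hA.1, hA.2 ▸ Nat.find_spec (hex A)⟩
  have hsum : ∀ k, ∑ A ∈ (hfin (k + 1)).toFinset,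
      odds p A * (4 * (1 + (gap k)⁻¹)) ^ A.1.card ≤ 1 / 4 := fun k => by
    refine hN k _ fun A hA => ?_
    obtain ⟨h1, h2⟩ := (hfin (k + 1)).mem_toFinset.1 hA
    refine ⟨h1, fun h => ?_⟩
    exact Nat.find_min (hex A) (m := k) (by omega) (h.mono (le_max_left _ _))
  refine ⟨fun A => Nat.find (hex A), fun k => (hfin k).toFinset, fun A v => ?_,
    fun k A => by rw [Set.Finite.mem_toFinset]; rfl, fun k => proposalMoment_le_one (hsum k),
    fun k => proposalMass_le (hsum k)⟩
  exact Nat.find_congr' fun {n} => spreadLE_translate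

end Levels

section Coding

open scoped NNReal ENNReal
open Classical

variable {d : ℕ}

/-- The corner of the bounding box of a finite set. -/
noncomputable def anchor (A : NonemptyFinset d) : IntLattice d := fun i => A.1.inf' A.2 fun x => x i

lemma anchor_translate (A : NonemptyFinset d) (v : IntLattice d) :
    anchor (A.translate v) = anchor A + v := by
  funext i
  refine le_antisymm ?_ ?_
  · obtain ⟨x, hx, h⟩ := Finset.exists_mem_eq_inf' A.2 fun x => x i
    rw [Pi.add_apply, anchor, anchor, h]
    refine Finset.inf'_le_of_le (b := x + v) _ ?_ le_rfl
    simpa using hx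
  · refine Finset.le_inf' _ _ fun x hx => ?_
    have : anchor A i ≤ (x - v) i := Finset.inf'_le (fun x : IntLattice d => x i) (by simpa using hx)
    simp only [Pi.add_apply, Pi.sub_apply] at this ⊢
    omega

/-- The index set of the randomness at a site: the marks of all levels and times, and one bit for
every finite set. -/
abbrev MarkIndex (d : ℕ) : Type := (ℕ × ℤ) ⊕ NonemptyFinset d

/-- The law of a bit, with odds `r` for `kill`. -/
noncomputable def bitLaw (d : ℕ) (r : ℝ≥0) : Measure (Mark d) :=
  ((r / (1 + r) : ℝ≥0) : ℝ≥0∞) • Measure.dirac .kill +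
    ((1 / (1 + r) : ℝ≥0) : ℝ≥0∞) • Measure.dirac .noop

lemma bitLaw_apply (r : ℝ≥0) (t : Set Bool) :
    bitLaw d r {x | decide (x = .kill) ∈ t} = bernMass r t := by
  by_cases h1 : true ∈ t <;> by_cases h2 : false ∈ t <;> simp [bitLaw, bernMass, h1, h2]

lemma bernMass_univ (r : ℝ≥0) : bernMass r Set.univ = 1 := by
  have : (1 + r) ≠ 0 := by positivity
  simp only [bernMass, Set.mem_univ, if_true]
  rw [← add_div, add_comm r, div_self this]

instance (r : ℝ≥0) : IsProbabilityMeasure (bitLaw d r) := ⟨by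
  have := bitLaw_apply (d := d) r Set.univ
  rw [bernMass_univ] at this
  have h : {x : Mark d | decide (x = .kill) ∈ (Set.univ : Set Bool)} = Set.univ := by
    ext x
    exact ⟨fun _ => trivial, fun _ => trivial⟩
  rw [← h, this, ENNReal.coe_one]⟩

/-- The law of the randomness at a site. -/
noncomputable def siteLaw (T : ℕ → Finset (NonemptyFinset d)) (p : NonemptyFinset d → ℝ) :
    MarkIndex d → Measure (Mark d)
  | .inl q => markLaw (T (q.1 + 1)) (odds p) (gap q.1)
  | .inr A => bitLaw d (odds p A)

instance (T : ℕ → Finset (NonemptyFinset d)) (p : NonemptyFinset d → ℝ) (i : MarkIndex d) :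
    IsProbabilityMeasure (siteLaw T p i) := by
  cases i <;> (unfold siteLaw; infer_instance)

/-- The law of the IID process. -/
noncomputable def fieldLaw (T : ℕ → Finset (NonemptyFinset d)) (p : NonemptyFinset d → ℝ) :
    Measure (IntLattice d → MarkIndex d → Mark d) :=
  Measure.infinitePi fun _ => Measure.infinitePi (siteLaw T p)

instance (T : ℕ → Finset (NonemptyFinset d)) (p : NonemptyFinset d → ℝ) :
    IsProbabilityMeasure (fieldLaw T p) := by unfold fieldLaw; infer_instance

/-- The coordinates of the IID process. -/
def coord (q : IntLattice d × MarkIndex d) (U : IntLattice d → MarkIndex d → Mark d) : Mark d :=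
  U q.1 q.2

lemma measurable_coord (q : IntLattice d × MarkIndex d) : Measurable (coord q) :=
  (measurable_pi_apply q.2).comp (measurable_pi_apply q.1)

variable (T : ℕ → Finset (NonemptyFinset d)) (p : NonemptyFinset d → ℝ)

lemma map_coord (q : IntLattice d × MarkIndex d) :
    (fieldLaw T p).map (coord q) = siteLaw T p q.2 := by
  have h : coord q = (fun x : MarkIndex d → Mark d => x q.2) ∘
    fun U : IntLattice d → MarkIndex d → Mark d => U q.1 := rfl
  rw [h, ← Measure.map_map (measurable_pi_apply _) (measurable_pi_apply _), fieldLaw,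
    Measure.infinitePi_map_eval, Measure.infinitePi_map_eval]

lemma iIndepFun_coord : iIndepFun (coord (d := d)) (fieldLaw T p) := by
  rw [iIndepFun_iff_map_fun_eq_infinitePi_map measurable_coord]
  simp only [map_coord]
  have h := Measure.infinitePi_map_curry (fun (_ : IntLattice d) => siteLaw T p)
  rw [fieldLaw, ← h, Measure.map_map (measurable_pi_lambda _ measurable_coord)
    (MeasurableEquiv.measurable _)]
  exact Measure.map_id

/-- The marks of a level. -/
def levelMarks (k : ℕ) (U : IntLattice d → MarkIndex d → Mark d) (e : Ev d) : Mark d :=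
  U e.site (.inl (k, e.time))

lemma measurable_levelMarks (k : ℕ) (e : Ev d) : Measurable fun U => levelMarks (d := d) k U e :=
  measurable_coord (e.site, .inl (k, e.time))

lemma iIndepFun_levelMarks (k : ℕ) :
    iIndepFun (fun (e : Ev d) U => levelMarks k U e) (fieldLaw T p) := by
  refine (iIndepFun_coord T p).precomp
    (g := fun e : Ev d => (e.site, (.inl (k, e.time) : MarkIndex d))) fun e f h => ?_
  rw [Prod.mk.injEq, Sum.inl.injEq, Prod.mk.injEq] at h
  rw [← Ev.mk_eta e, ← Ev.mk_eta f, h.1, h.2.2]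

lemma map_levelMarks (k : ℕ) (e : Ev d) :
    (fieldLaw T p).map (fun U => levelMarks k U e) = markLaw (T (k + 1)) (odds p) (gap k) :=
  map_coord T p (e.site, .inl (k, e.time))

/-- The selected sets, as a function of the IID process. -/
noncomputable def coding (level : NonemptyFinset d → ℕ) (T : ℕ → Finset (NonemptyFinset d))
    (U : IntLattice d → MarkIndex d → Mark d) (A : NonemptyFinset d) : Bool :=
  match level A with
  | 0 => decide (U (anchor A) (.inr (A.translate (-anchor A))) = .kill)
  | k + 1 => decide (A ∈ limitSets (T (k + 1)) (past (levelMarks k U)))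

variable {T p} {level : NonemptyFinset d → ℕ}

lemma coding_zero {A : NonemptyFinset d} (h : level A = 0)
    (U : IntLattice d → MarkIndex d → Mark d) :
    coding level T U A = decide (U (anchor A) (.inr (A.translate (-anchor A))) = .kill) := by
  unfold coding; rw [h]

lemma coding_succ {A : NonemptyFinset d} {k : ℕ} (h : level A = k + 1)
    (U : IntLattice d → MarkIndex d → Mark d) :
    coding level T U A = decide (A ∈ limitSets (T (k + 1)) (past (levelMarks k U))) := by
  unfold coding; rw [h]

/-- The coordinates that belong to a level. -/
def levelCoords (d k : ℕ) : Set (IntLattice d × MarkIndex d) :=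
  {q | match q.2 with
    | .inl x => x.1 + 1 = k
    | .inr _ => 0 = k}

lemma measurable_coding_level (A : NonemptyFinset d) :
    Measurable[blockAlgebra coord (levelCoords d (level A))] fun U => coding level T U A := by
  rcases h : level A with _ | k
  · simp only [coding_zero h]
    have h1 : Measurable[blockAlgebra coord (levelCoords d 0)]
        (coord (anchor A, .inr (A.translate (-anchor A)))) :=
      measurable_blockAlgebra_of_mem (D := levelCoords d 0) rfl
    exact (Measurable.of_discrete (f := fun x : Mark d => decide (x = .kill))).comp h1
  · simp only [coding_succ h]
    have h1 : Measurable[blockAlgebra coord (levelCoords d (k + 1))]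
        (levelMarks (d := d) k) := by
      refine @measurable_pi_lambda _ _ _ (blockAlgebra coord (levelCoords d (k + 1))) _ _
        fun e => ?_
      exact measurable_blockAlgebra_of_mem (m := coord) (D := levelCoords d (k + 1))
        (i := (e.site, .inl (k, e.time))) rfl
    exact (Measurable.of_discrete (f := fun x : Prop => decide x)).comp
      ((measurable_mem_limitSets A).comp (measurable_past.comp h1))

lemma measurable_coding : Measurable (coding level T) :=
  measurable_pi_lambda _ fun A => (measurable_coding_level A).mono
    (blockAlgebra_le measurable_coord _) le_rfl

/-- The properties of the levels that make the coding work. -/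
structure IsLevel (level : NonemptyFinset d → ℕ) (T : ℕ → Finset (NonemptyFinset d))
    (p : NonemptyFinset d → ℝ) : Prop where
  level_translate : ∀ A v, level (A.translate v) = level A
  mem_iff : ∀ k A, A ∈ T k ↔ (0 : IntLattice d) ∈ A.1 ∧ level A = k
  moment_le : ∀ k, proposalMoment (T (k + 1)) (odds p) (gap k) ≤ 1
  mass_le : ∀ k, proposalMass (T (k + 1)) (odds p) (gap k) ≤ 2 * gap k
  inv : ∀ A v, p (A.translate v) = p A

namespace IsLevel

variable (hL : IsLevel level T p)

include hL

lemma zero_mem (k : ℕ) : ∀ A ∈ T k, (0 : IntLattice d) ∈ A.1 := fun A hA => ((hL.mem_iff k A).1 hA).1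

lemma translate_mem (k : ℕ) : ∀ A ∈ T k, ∀ u ∈ A.1, A.translate (-u) ∈ T k := fun A hA u hu =>
  (hL.mem_iff k _).2 ⟨by simpa using hu, by rw [hL.level_translate, ((hL.mem_iff k A).1 hA).2]⟩

lemma odds_translate (A : NonemptyFinset d) (v : IntLattice d) :
    odds p (A.translate v) = odds p A := by
  unfold odds; rw [hL.inv]

lemma ae_determined (k : ℕ) : ∀ᵐ U ∂(fieldLaw T p), ∀ u, ∃ n,
    Determined (T (k + 1)) (past (levelMarks k U)) n u (Ev.final d) :=
  _root_.ae_determined (m := fun e U => levelMarks k U e) (measurable_levelMarks k)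
    (iIndepFun_levelMarks T p k) (map_levelMarks T p k) (hL.moment_le k) (two_mul_gap_lt_one k)

lemma measure_coding_level (k : ℕ) {𝒜 : Finset (NonemptyFinset d)} (h𝒜 : ∀ A ∈ 𝒜, level A = k)
    (t : NonemptyFinset d → Set Bool) :
    fieldLaw T p {U | ∀ A ∈ 𝒜, coding level T U A ∈ t A} =
      ∏ A ∈ 𝒜, (bernMass (odds p A) (t A) : ℝ≥0∞) := by
  cases k with
  | zero =>
    -- A set is recovered from its corner and its shape, so distinct sets read distinct bits.
    have hinj : Function.Injective fun A : NonemptyFinset d =>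
        (anchor A, (.inr (A.translate (-anchor A)) : MarkIndex d)) := fun A B h => by
      rw [Prod.mk.injEq, Sum.inr.injEq] at h
      have h2 := congrArg (fun C : NonemptyFinset d => C.translate (anchor A)) h.2
      rw [h.1] at h2
      simpa using h2
    have hind := (iIndepFun_coord T p).precomp hinj
    have hset : {U | ∀ A ∈ 𝒜, coding level T U A ∈ t A} = ⋂ A ∈ 𝒜,
        coord (anchor A, .inr (A.translate (-anchor A))) ⁻¹' {x | decide (x = .kill) ∈ t A} := by
      ext U
      simp only [Set.mem_iInter]
      refine forall₂_congr fun A hA => ?_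
      rw [coding_zero (h𝒜 A hA)]
      rfl
    rw [hset, hind.measure_inter_preimage_eq_mul 𝒜
      (sets := fun A => {x | decide (x = .kill) ∈ t A}) fun _ _ => MeasurableSet.of_discrete]
    refine Finset.prod_congr rfl fun A _ => ?_
    rw [← Measure.map_apply (measurable_coord _) MeasurableSet.of_discrete, map_coord]
    simp only [siteLaw]
    rw [bitLaw_apply, hL.odds_translate]
  | succ k =>
    rw [← measure_limitSets (m := fun e U => levelMarks k U e) (measurable_levelMarks k)
      (iIndepFun_levelMarks T p k) (map_levelMarks T p k) (hL.zero_mem _) (hL.translate_mem _)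
      hL.odds_translate (gap_ne_zero k) (hL.ae_determined k) (𝒜 := 𝒜) (fun A hA u hu =>
        (hL.mem_iff _ _).2 ⟨by simpa using hu, by rw [hL.level_translate, h𝒜 A hA]⟩) t]
    congr 1
    ext U
    refine forall₂_congr fun A hA => ?_
    rw [coding_succ (h𝒜 A hA)]

lemma measure_coding (𝒜 : Finset (NonemptyFinset d)) (t : NonemptyFinset d → Set Bool) :
    fieldLaw T p {U | ∀ A ∈ 𝒜, coding level T U A ∈ t A} =
      ∏ A ∈ 𝒜, (bernMass (odds p A) (t A) : ℝ≥0∞) := by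
  -- Levels are added one at a time; each reads coordinates disjoint from those of all others.
  have key : ∀ K : Finset ℕ, fieldLaw T p {U | ∀ A ∈ 𝒜, level A ∈ K → coding level T U A ∈ t A} =
      ∏ A ∈ 𝒜 with level A ∈ K, (bernMass (odds p A) (t A) : ℝ≥0∞) := by
    intro K
    induction K using Finset.induction_on with
    | empty => simp
    | insert k K hk ih =>
      have hmeas : ∀ (D : Set (IntLattice d × MarkIndex d)) (q : NonemptyFinset d → Prop),
          (∀ A, q A → levelCoords d (level A) ⊆ D) → MeasurableSet[blockAlgebra coord D]
            {U | ∀ A ∈ 𝒜, q A → coding level T U A ∈ t A} := by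
        intro D q hD
        have : {U | ∀ A ∈ 𝒜, q A → coding level T U A ∈ t A} =
            ⋂ A, ⋂ (_ : A ∈ 𝒜), ⋂ (_ : q A), {U | coding level T U A ∈ t A} := by
          ext U; simp
        rw [this]
        refine MeasurableSet.iInter fun A => MeasurableSet.iInter fun _ =>
          MeasurableSet.iInter fun hA => ?_
        exact ((measurable_coding_level A).mono (biSup_mono fun _ h => hD A hA h) le_rfl)
          MeasurableSet.of_discrete
      have hdisj : Disjoint (levelCoords d k) (⋃ j ∈ K, levelCoords d j) := by
        rw [Set.disjoint_left]
        rintro ⟨v, i⟩ h1 h2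
        simp only [Set.mem_iUnion] at h2
        obtain ⟨j, hj, h2⟩ := h2
        refine hk ?_
        have : k = j := by
          cases i with
          | inl x => exact (Eq.symm (h1 : x.1 + 1 = k)).trans (h2 : x.1 + 1 = j)
          | inr x => exact (Eq.symm (h1 : 0 = k)).trans (h2 : 0 = j)
        rwa [this]
      have hset : {U | ∀ A ∈ 𝒜, level A ∈ insert k K → coding level T U A ∈ t A} =
          {U | ∀ A ∈ 𝒜, level A = k → coding level T U A ∈ t A} ∩
            {U | ∀ A ∈ 𝒜, level A ∈ K → coding level T U A ∈ t A} := by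
        ext U
        simp only [Finset.mem_insert]
        exact ⟨fun h => ⟨fun A hA h' => h A hA (Or.inl h'), fun A hA h' => h A hA (Or.inr h')⟩,
          fun h A hA h' => h'.elim (h.1 A hA) (h.2 A hA)⟩
      rw [hset, (Indep_iff _ _ _).1 (indep_blockAlgebra measurable_coord (iIndepFun_coord T p)
        hdisj) _ _ (hmeas _ (fun A => level A = k) fun A hA => by rw [hA])
        (hmeas _ (fun A => level A ∈ K) fun A hA => Set.subset_biUnion_of_mem
          (u := fun j => levelCoords d j) hA), ih]
      have h1 := hL.measure_coding_level k (𝒜 := {A ∈ 𝒜 | level A = k})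
        (fun A hA => (Finset.mem_filter.1 hA).2) t
      have h2 : {U | ∀ A ∈ ({A ∈ 𝒜 | level A = k} : Finset (NonemptyFinset d)),
          coding level T U A ∈ t A} = {U | ∀ A ∈ 𝒜, level A = k → coding level T U A ∈ t A} := by
        ext U
        simp only [Finset.mem_filter]
        exact ⟨fun h A hA h' => h A ⟨hA, h'⟩, fun h A hA => h A hA.1 hA.2⟩
      rw [← h2, h1, ← Finset.prod_union]
      · congr 1
        ext A
        simp only [Finset.mem_union, Finset.mem_filter, Finset.mem_insert]
        tauto
      · rw [Finset.disjoint_left]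
        intro A h1 h2
        exact hk ((Finset.mem_filter.1 h1).2 ▸ (Finset.mem_filter.1 h2).2)
  have h := key (𝒜.image level)
  have h1 : {U | ∀ A ∈ 𝒜, level A ∈ 𝒜.image level → coding level T U A ∈ t A} =
      {U | ∀ A ∈ 𝒜, coding level T U A ∈ t A} := by
    ext U
    exact forall₂_congr fun A hA =>
      ⟨fun h => h (Finset.mem_image_of_mem _ hA), fun h _ => h⟩
  rw [h1] at h
  rw [h]
  congr 1
  exact Finset.filter_true_of_mem fun A hA => Finset.mem_image_of_mem _ hA

/-- The coding has the law of the given family of independent random variables. -/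
theorem map_coding {Ω : Type*} [MeasurableSpace Ω] {P : Measure Ω} [IsProbabilityMeasure P]
    {X : NonemptyFinset d → Ω → Bool} (hX : ∀ A, Measurable (X A)) (hXi : iIndepFun X P)
    (hlaw : ∀ A, P.real {ω | X A ω = true} = p A) (hp : ∀ A, p A < 1) :
    (fieldLaw T p).map (coding level T) = P.map fun ω A => X A ω := by
  rw [(iIndepFun_iff_map_fun_eq_infinitePi_map hX).1 hXi]
  have hprob : ∀ A, IsProbabilityMeasure (P.map (X A)) := fun A =>
    Measure.isProbabilityMeasure_map (hX A).aemeasurable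
  refine Measure.eq_infinitePi _ fun 𝒜 t ht => ?_
  have hpi : MeasurableSet ((𝒜 : Set (NonemptyFinset d)).pi t) :=
    MeasurableSet.pi 𝒜.countable_toSet fun A _ => ht A
  rw [Measure.map_apply measurable_coding hpi]
  have hset : coding level T ⁻¹' (𝒜 : Set (NonemptyFinset d)).pi t =
      {U | ∀ A ∈ 𝒜, coding level T U A ∈ t A} := rfl
  rw [hset, hL.measure_coding]
  refine Finset.prod_congr rfl fun A _ => ?_
  have h0 : 0 ≤ p A := (hlaw A) ▸ measureReal_nonneg
  have h1 := hp A
  have htrue : P (X A ⁻¹' {true}) = ENNReal.ofReal (p A) := by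
    rw [← hlaw A, measureReal_def, ENNReal.ofReal_toReal (measure_ne_top _ _)]
    rfl
  have hfalse : P (X A ⁻¹' {false}) = ENNReal.ofReal (1 - p A) := by
    have : X A ⁻¹' {false} = (X A ⁻¹' {true})ᶜ := by ext ω; simp
    rw [this, prob_compl_eq_one_sub (hX A MeasurableSet.of_discrete), htrue,
      ENNReal.ofReal_sub _ h0, ENNReal.ofReal_one]
  have hodds : (odds p A : ℝ) = p A / (1 - p A) :=
    Real.coe_toNNReal _ (div_nonneg h0 (by linarith))
  have hne : 1 - p A ≠ 0 := by linarith
  have hot : odds p A / (1 + odds p A) = Real.toNNReal (p A) := by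
    rw [← NNReal.coe_inj, Real.coe_toNNReal _ h0]
    push_cast
    rw [hodds]
    field_simp
    ring
  have hof : 1 / (1 + odds p A) = Real.toNNReal (1 - p A) := by
    rw [← NNReal.coe_inj, Real.coe_toNNReal _ (by linarith)]
    push_cast
    rw [hodds]
    field_simp
    ring
  rw [Measure.map_apply (hX A) (ht A), bernMass, hot, hof]
  by_cases h1 : true ∈ t A <;> by_cases h2 : false ∈ t A
  · have : t A = {false} ∪ {true} := by ext b; cases b <;> simp [h1, h2]
    rw [this, Set.preimage_union, measure_union _ (hX A MeasurableSet.of_discrete), htrue, hfalse]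
    · simp [ENNReal.ofReal, add_comm]
    · exact Disjoint.preimage _ (by simp)
  · have : t A = {true} := by ext b; cases b <;> simp [h1, h2]
    rw [this, htrue]; simp [ENNReal.ofReal]
  · have : t A = {false} := by ext b; cases b <;> simp [h1, h2]
    rw [this, hfalse]; simp [ENNReal.ofReal]
  · have : t A = ∅ := by ext b; cases b <;> simp [h1, h2]
    rw [this]; simp

/-- The coding is translation equivariant. -/
theorem ae_coding_shift (v : IntLattice d) : ∀ᵐ U ∂(fieldLaw T p), ∀ A,
    coding level T (shift v U) (A.translate v) = coding level T U A := by
  filter_upwards [ae_all_iff.2 hL.ae_determined] with U hU A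
  rcases h : level A with _ | k
  · rw [coding_zero h, coding_zero (by rw [hL.level_translate, h]), anchor_translate]
    have h1 : (A.translate v).translate (-(anchor A + v)) = A.translate (-anchor A) := by
      rw [NonemptyFinset.translate_translate]
      congr 1
      abel
    rw [h1]
    simp only [shift, add_sub_cancel_right]
  · rw [coding_succ h, coding_succ (by rw [hL.level_translate, h])]
    obtain ⟨u, hu⟩ := A.2
    obtain ⟨n, hn⟩ := hU k u
    obtain ⟨N, hN⟩ := (hn.eventually_restrictTo fun e he => past_of_nonneg _ he).exists
    have h1 := hN.translate_mem_limitSets_iff (hL.zero_mem _) (hL.translate_mem _)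
      (fun e he => past_of_nonneg _ he) hu v
    have h2 : past (levelMarks k (shift v U)) =
        fun e : Ev d => past (levelMarks k U) (e.shift (-v)) := by
      funext e
      simp only [past, levelMarks, shift, Ev.time_shift, Ev.site_shift, sub_eq_add_neg]
      rfl
    rw [h2]
    simp only [h1]

end IsLevel

end Coding

section Finitary

open scoped NNReal ENNReal
open Classical

variable {d : ℕ}

/-! ### Coding radii -/

lemma measurable_eval_ball {S : Type*} [MeasurableSpace S] {n : ℕ} {v : IntLattice d}
    (hv : ‖v‖ ≤ (n : ℝ)) : Measurable[ballFiltration d S n] fun U : IntLattice d → S => U v :=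
  measurable_iff_comap_le.2 (le_iSup₂_of_le
    (f := fun (v : IntLattice d) (_ : ‖v‖ ≤ (n : ℝ)) =>
      MeasurableSpace.comap (fun U : IntLattice d → S => U v) inferInstance) v hv le_rfl)

/-- The σ-algebra of a stopping time that may be `⊤` also asks for measurability with respect to the
whole filtration. -/
lemma pi_le_iSup_ballFiltration {S : Type*} [MeasurableSpace S] :
    (MeasurableSpace.pi : MeasurableSpace (IntLattice d → S)) ≤ ⨆ n, ballFiltration d S n := by
  refine iSup_le fun v => ?_
  obtain ⟨n, hn⟩ := exists_nat_ge ‖v‖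
  exact (measurable_eval_ball hn).comap_le.trans (le_iSup (fun n => ballFiltration d S n) n)

/-- The configuration in the ball of radius `n`, extended by the constant `c`. -/
noncomputable def truncate {S : Type*} (n : ℕ) (c : S) (U : IntLattice d → S) : IntLattice d → S :=
  fun v => if ‖v‖ ≤ (n : ℝ) then U v else c

lemma truncate_of_le {S : Type*} {n : ℕ} {c : S} {U : IntLattice d → S} {v : IntLattice d}
    (hv : ‖v‖ ≤ (n : ℝ)) : truncate n c U v = U v := if_pos hv

lemma measurable_truncate {S : Type*} [MeasurableSpace S] (n : ℕ) (c : S) :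
    Measurable[ballFiltration d S n] (truncate (d := d) n c) := by
  refine @measurable_pi_lambda _ _ _ (ballFiltration d S n) _ _ fun v => ?_
  by_cases hv : ‖v‖ ≤ (n : ℝ)
  · simp only [truncate, hv, if_true]
    exact measurable_eval_ball hv
  · simp only [truncate, hv, if_false]
    exact measurable_const

/-- A function that is almost surely determined in a finite ball has a coding radius. -/
theorem exists_codingRadius {S E : Type*} [MeasurableSpace S] [MeasurableSpace E]
    {Q : Measure (IntLattice d → S)} {f : (IntLattice d → S) → E} (hf : Measurable f) (c : S)
    (D : ℕ → Set (IntLattice d → S)) (hD : ∀ n, MeasurableSet[ballFiltration d S n] (D n))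
    (hfD : ∀ n, ∀ U ∈ D n, f (truncate n c U) = f U) (hQ : ∀ᵐ U ∂Q, ∃ n, U ∈ D n) :
    ∃ (R : (IntLattice d → S) → WithTop ℕ) (hR : IsStoppingTime (ballFiltration d S) R),
      (∀ᵐ U ∂Q, R U ≠ ⊤) ∧ Measurable[hR.measurableSpace] f := by
  let R : (IntLattice d → S) → WithTop ℕ := fun U =>
    if h : ∃ n, U ∈ D n then WithTop.some (Nat.find h) else ⊤
  have hRle : ∀ n : ℕ, {U | R U ≤ WithTop.some n} = ⋃ m ≤ n, D m := by
    intro n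
    ext U
    simp only [Set.mem_iUnion, exists_prop]
    change R U ≤ WithTop.some n ↔ _
    by_cases h : ∃ n, U ∈ D n
    · simp only [R, h, dif_pos, WithTop.coe_le_coe]
      rw [Nat.find_le_iff]
    · simp only [R, h, dif_neg, not_false_iff, top_le_iff, WithTop.coe_ne_top, false_iff]
      exact fun ⟨m, _, hm⟩ => h ⟨m, hm⟩
  have hD' : ∀ n, ∀ m ≤ n, MeasurableSet[ballFiltration d S n] (D m) := fun n m hm =>
    (ballFiltration d S).mono hm _ (hD m)
  have hR : IsStoppingTime (ballFiltration d S) R := by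
    intro n
    rw [hRle]
    exact MeasurableSet.iUnion fun m => MeasurableSet.iUnion fun hm => hD' n m hm
  refine ⟨R, hR, ?_, ?_⟩
  · filter_upwards [hQ] with U hU
    simp [R, hU]
  · intro s hs
    refine ⟨pi_le_iSup_ballFiltration _ (hf hs), fun n => ?_⟩
    rw [hRle]
    -- On `D m` the function may be evaluated at the truncated configuration, which is measurable
    -- with respect to the ball of radius `m`.
    have : f ⁻¹' s ∩ ⋃ m ≤ n, D m =
        ⋃ m, ⋃ (_ : m ≤ n), ((fun U => f (truncate m c U)) ⁻¹' s ∩ D m) := by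
      ext U
      simp only [Set.mem_inter_iff, Set.mem_iUnion, Set.mem_preimage, exists_prop]
      constructor
      · rintro ⟨h1, m, hm, h2⟩
        exact ⟨m, hm, by rwa [hfD m U h2], h2⟩
      · rintro ⟨m, hm, h1, h2⟩
        exact ⟨by rwa [← hfD m U h2], m, hm, h2⟩
    rw [this]
    refine MeasurableSet.iUnion fun m => MeasurableSet.iUnion fun hm =>
      MeasurableSet.inter ?_ (hD' n m hm)
    exact (ballFiltration d S).mono hm _ ((hf.comp (measurable_truncate m c)) hs)

variable {T : ℕ → Finset (NonemptyFinset d)} {p : NonemptyFinset d → ℝ}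
  {level : NonemptyFinset d → ℕ}

/-- The marks in the ball of radius `n` determine the sets through the origin. -/
def IsCertified (T : ℕ → Finset (NonemptyFinset d)) (n : ℕ)
    (U : IntLattice d → MarkIndex d → Mark d) : Prop :=
  (∀ A ∈ T 0, ‖anchor A‖ ≤ (n : ℝ)) ∧ ∃ K : ℕ, (∀ k, K ≤ k → levelMarks k U (Ev.mk (-1) 0) = .kill) ∧
    ∀ k < K, ∃ l, Determined (T (k + 1)) (restrictTo (win d n) (past (levelMarks k U))) l 0
      (Ev.final d)

lemma restrictTo_past_levelMarks {n k : ℕ} {U U' : IntLattice d → MarkIndex d → Mark d}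
    (h : ∀ v, ‖v‖ ≤ (n : ℝ) → U' v = U v) :
    restrictTo (win d n) (past (levelMarks k U')) = restrictTo (win d n) (past (levelMarks k U)) := by
  funext e
  unfold restrictTo
  by_cases he : e ∈ win d n
  · rw [if_pos he, if_pos he]
    simp only [past, levelMarks, h _ (mem_win.1 he).2]
  · rw [if_neg he, if_neg he]

lemma isCertified_congr {n : ℕ} {U U' : IntLattice d → MarkIndex d → Mark d}
    (h : ∀ v, ‖v‖ ≤ (n : ℝ) → U' v = U v) : IsCertified T n U' ↔ IsCertified T n U := by
  have h0 : U' 0 = U 0 := h 0 (by simp)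
  unfold IsCertified
  simp only [restrictTo_past_levelMarks h]
  simp only [levelMarks, Ev.site_mk, h0]

lemma measurable_isCertified (n : ℕ) : Measurable (IsCertified T n) := by
  refine measurable_const.and (Measurable.exists fun K => Measurable.and ?_ ?_)
  · exact Measurable.forall fun k => measurable_const.imp
      ((Measurable.of_discrete (f := fun x : Mark d => x = .kill)).comp (measurable_levelMarks k _))
  · refine Measurable.forall fun k => measurable_const.imp (Measurable.exists fun l => ?_)
    exact (measurable_determined l 0 _).comp ((measurable_restrictTo _).comp
      (measurable_past.comp (measurable_pi_lambda _ (measurable_levelMarks k))))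

lemma measurableSet_isCertified (n : ℕ) :
    MeasurableSet[ballFiltration d (MarkIndex d → Mark d) n] {U | IsCertified T n U} := by
  have h : {U | IsCertified T n U} =
      {U | IsCertified T n (truncate n (fun _ => Mark.noop) U)} := by
    ext U
    exact (isCertified_congr fun v hv => truncate_of_le hv).symm
  rw [h]
  exact (@measurableSet_setOfPred _ (ballFiltration d (MarkIndex d → Mark d) n) _).2
    ((measurable_isCertified n).comp (measurable_truncate n _))

namespace IsLevel

variable (hL : IsLevel level T p)

include hL

/-- On level 0 the corners lie in the ball. From level `K + 1` on, the deletion at the origin in the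
last round excludes every set through it. The levels in between have certificates inside the ball.
-/
lemma coding_congr {n : ℕ} {U U' : IntLattice d → MarkIndex d → Mark d}
    (h : ∀ v, ‖v‖ ≤ (n : ℝ) → U' v = U v) (hU : IsCertified T n U) {A : NonemptyFinset d}
    (hA : (0 : IntLattice d) ∈ A.1) : coding level T U' A = coding level T U A := by
  obtain ⟨h1, K, h2, h3⟩ := hU
  rcases hk : level A with _ | k
  · rw [coding_zero hk, coding_zero hk, h _ (h1 A ((hL.mem_iff 0 A).2 ⟨hA, hk⟩))]
  · rw [coding_succ hk, coding_succ hk]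
    rcases le_or_gt K k with hKk | hKk
    · have h0 : U' 0 = U 0 := h 0 (by simp)
      have hkill : ∀ V : IntLattice d → MarkIndex d → Mark d, V 0 = U 0 →
          A ∉ limitSets (T (k + 1)) (past (levelMarks k V)) := fun V hV => by
        refine notMem_limitSets_of_kill (fun e he => past_of_nonneg _ he) (u := 0) ?_ hA
        rw [past_of_neg _ (by simp)]
        have := h2 k hKk
        simp only [levelMarks, Ev.site_mk] at this ⊢
        rw [hV]
        exact this
      rw [decide_eq_false (hkill U' h0), decide_eq_false (hkill U rfl)]
    · obtain ⟨l, hl⟩ := h3 k hKk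
      have := hl.mem_limitSets_congr (M' := past (levelMarks k U')) (hL.zero_mem _)
        (hL.translate_mem _) (fun e he => past_of_nonneg _ he)
        (by rw [← restrictTo_past_levelMarks h]; exact extends_restrictTo _ _)
        (fun e he => past_of_nonneg _ he) hA
      simp only [this]

/-- The probability of no deletion is `killProb` times the proposal mass. Its summability over `k`
is the reason for the geometric decay of `gap`. -/
lemma measure_ne_kill_le (k : ℕ) :
    fieldLaw T p {U | levelMarks k U (Ev.mk (-1) 0) ≠ .kill} ≤ 2 * gap k := by
  have h1 : fieldLaw T p {U | levelMarks k U (Ev.mk (-1) 0) ≠ .kill} =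
      markLaw (T (k + 1)) (odds p) (gap k) {.kill}ᶜ := by
    rw [← map_levelMarks T p k (Ev.mk (-1) 0),
      Measure.map_apply (measurable_levelMarks k _) MeasurableSet.of_discrete]
    rfl
  rw [h1, markLaw_compl_kill, tsub_le_iff_left]
  calc (1 : ℝ≥0∞) = killProb (T (k + 1)) (odds p) (gap k) *
        (1 + proposalMass (T (k + 1)) (odds p) (gap k)) := (killProb_mul _ _ _).symm
    _ ≤ killProb (T (k + 1)) (odds p) (gap k) +
        proposalMass (T (k + 1)) (odds p) (gap k) := by
      rw [mul_add, mul_one]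
      gcongr
      exact mul_le_of_le_one_left zero_le (ENNReal.coe_le_one_iff.2 killProb_le_one)
    _ ≤ _ := by
      gcongr
      exact_mod_cast hL.mass_le k

/-- Borel–Cantelli leaves finitely many levels without a deletion at the origin in the last round,
and each of these has a finite certificate almost surely. -/
lemma ae_isCertified : ∀ᵐ U ∂(fieldLaw T p), ∃ n, U ∈ {U | IsCertified T n U} := by
  have hsum : ∑' k, fieldLaw T p {U | levelMarks k U (Ev.mk (-1) 0) ≠ .kill} ≠ ⊤ := by
    refine ne_top_of_le_ne_top ?_ (ENNReal.tsum_le_tsum hL.measure_ne_kill_le)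
    have hs : Summable fun k => 2 * gap k := by
      unfold gap
      exact ((NNReal.summable_geometric (by norm_num)).mul_left _).mul_left _
    have := ENNReal.tsum_coe_ne_top_iff_summable.2 hs
    simpa using this
  filter_upwards [ae_eventually_notMem hsum, ae_all_iff.2 hL.ae_determined] with U h1 h2
  obtain ⟨K, hK⟩ := Filter.eventually_atTop.1 h1
  have h3 : ∀ k ∈ Finset.range K, ∀ᶠ n in Filter.atTop, ∃ l, Determined (T (k + 1))
      (restrictTo (win d n) (past (levelMarks k U))) l 0 (Ev.final d) := fun k _ => by
    obtain ⟨l, hl⟩ := h2 k 0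
    filter_upwards [hl.eventually_restrictTo fun e he => past_of_nonneg _ he] with n hn
    exact ⟨l, hn⟩
  have h4 : ∀ A ∈ T 0, ∀ᶠ n : ℕ in Filter.atTop, ‖anchor A‖ ≤ (n : ℝ) := fun A _ =>
    tendsto_natCast_atTop_atTop.eventually_ge_atTop ‖anchor A‖
  obtain ⟨n, hn3, hn4⟩ := (((Filter.eventually_all_finset _).2 h3).and
    ((Filter.eventually_all_finset _).2 h4)).exists
  exact ⟨n, hn4, K, fun k hk => not_not.1 (hK k hk), fun k hk => hn3 k (Finset.mem_range.2 hk)⟩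

/-- Processes that are local functions of the selected sets through a site are finitary factors. -/
theorem isFinitaryFactorOfIID {Ω E : Type*} [MeasurableSpace Ω] [MeasurableSpace E] {P : Measure Ω}
    [IsProbabilityMeasure P] {X : NonemptyFinset d → Ω → Bool} (hX : ∀ A, Measurable (X A))
    (hXi : iIndepFun X P) (hlaw : ∀ A, P.real {ω | X A ω = true} = p A) (hp : ∀ A, p A < 1)
    {θ : Set (OriginFinset d) → E} (hθ : Measurable θ) :
    IsFinitaryFactorOfIID P fun v ω => θ (selectedSets X v ω) := by
  let Φ : (NonemptyFinset d → Bool) → IntLattice d → E := fun y v =>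
    θ (selectedSets (fun A (y : NonemptyFinset d → Bool) => y A) v y)
  have hΦ : Measurable Φ := by
    refine measurable_pi_lambda _ fun v => hθ.comp (measurable_set_iff.2 fun A => ?_)
    exact (Measurable.of_discrete (f := fun b : Bool => b = true)).comp
      (measurable_pi_apply (A.1.translate v))
  have hF : Measurable fun U => Φ (coding level T U) := hΦ.comp measurable_coding
  have hXm : Measurable fun ω A => X A ω := measurable_pi_lambda _ hX
  have htrans : ∀ v : IntLattice d, ∀ᵐ U ∂(fieldLaw T p),
      Φ (coding level T (shift v U)) = shift v (Φ (coding level T U)) := by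
    intro v
    filter_upwards [hL.ae_coding_shift v] with U hU
    funext w
    simp only [Φ, shift]
    congr 1
    ext A
    change coding level T (shift v U) (A.1.translate w) = true ↔
      coding level T U (A.1.translate (w - v)) = true
    rw [← hU, NonemptyFinset.translate_translate, sub_add_cancel]
  refine ⟨MarkIndex d → Mark d, inferInstance, inferInstance, Measure.infinitePi (siteLaw T p),
    inferInstance, fun U => Φ (coding level T U), hF, htrans, ⟨?_, hF.aemeasurable, ?_⟩, ?_⟩
  · exact (hΦ.comp hXm).aemeasurable
  · change P.map (Φ ∘ fun ω A => X A ω) = (fieldLaw T p).map (Φ ∘ coding level T)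
    rw [← Measure.map_map hΦ hXm, ← Measure.map_map hΦ measurable_coding,
      hL.map_coding hX hXi hlaw hp]
  · refine exists_codingRadius (Q := fieldLaw T p) ((measurable_pi_apply 0).comp hF)
      (fun _ => Mark.noop) (fun n => {U | IsCertified T n U}) measurableSet_isCertified
      (fun n U hU => ?_) hL.ae_isCertified
    simp only [Φ]
    congr 1
    ext A
    change coding level T _ (A.1.translate 0) = true ↔ coding level T U (A.1.translate 0) = true
    rw [NonemptyFinset.translate_zero, hL.coding_congr (fun v hv => truncate_of_le hv) hU A.2]

end IsLevel

/-! ### The processes of the selected sets -/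

/-- This brings `X̄` to the form `θ (selectedSets X v ω)`, so that both processes fall under one
theorem. -/
lemma unionProcess_eq {Ω : Type*} (X : NonemptyFinset d → Ω → Bool) :
    unionProcess X = fun v ω => decide (selectedSets X v ω).Nonempty := by
  funext v ω
  unfold unionProcess
  congr 1
  simp only [unionSet, Set.mem_iUnion, Finset.mem_coe, exists_prop, eq_iff_iff]
  constructor
  · rintro ⟨A, hA, hv⟩
    refine ⟨⟨A.translate (-v), by simpa using hv⟩, ?_⟩
    change X ((A.translate (-v)).translate v) ω = true
    simpa using hA
  · rintro ⟨A, hA⟩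
    exact ⟨A.1.translate v, hA, by simpa using A.2⟩

lemma measurable_nonempty_set {α : Type*} [Countable α] :
    Measurable fun s : Set α => decide s.Nonempty :=
  (Measurable.of_discrete (f := fun q : Prop => decide q)).comp
    (Measurable.exists fun a => measurable_set_mem a)

/-- Finiteness is expressed as containment in one of the countably many finite sets `F`. -/
lemma measurable_toFinset_set {α : Type*} [Countable α] :
    Measurable fun s : Set α => if h : s.Finite then h.toFinset else ∅ := by
  refine measurable_finset_iff.2 fun a => ?_
  have h : (fun s : Set α => a ∈ if h : s.Finite then h.toFinset else ∅) =
      fun s : Set α => a ∈ s ∧ ∃ F : Finset α, ∀ b, b ∈ s → b ∈ F := by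
    funext s
    by_cases hs : s.Finite
    · simp only [hs, dif_pos, Set.Finite.mem_toFinset, eq_iff_iff, iff_self_and]
      exact fun _ => ⟨hs.toFinset, fun b hb => hs.mem_toFinset.2 hb⟩
    · simp only [hs, dif_neg, not_false_iff, Finset.notMem_empty, eq_iff_iff, false_iff]
      rintro ⟨-, F, hF⟩
      exact hs (F.finite_toSet.subset hF)
  rw [h]
  exact (measurable_set_mem a).and (Measurable.exists fun F => Measurable.forall fun b =>
    (measurable_set_mem b).imp measurable_const)

lemma ae_finite_selectedSets {Ω : Type*} [MeasurableSpace Ω] {P : Measure Ω}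
    [IsProbabilityMeasure P] {p : NonemptyFinset d → ℝ} {X : NonemptyFinset d → Ω → Bool}
    (hlaw : ∀ A, P.real {ω | X A ω = true} = p A)
    (hinv : ∀ (A : NonemptyFinset d) (v : IntLattice d), p (A.translate v) = p A)
    (hsum : Summable fun A : OriginFinset d => p A.1) :
    ∀ᵐ ω ∂P, ∀ v, (selectedSets X v ω).Finite := by
  refine ae_all_iff.2 fun v => ?_
  refine ae_finite_setOfPred_mem (s := fun A : OriginFinset d => {ω | X (A.1.translate v) ω = true}) ?_
  have h : ∀ A : OriginFinset d, P {ω | X (A.1.translate v) ω = true} = ENNReal.ofReal (p A.1) := by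
    intro A
    rw [← hinv A.1 v, ← hlaw, measureReal_def, ENNReal.ofReal_toReal (measure_ne_top _ _)]
  simp only [h]
  exact hsum.tsum_ofReal_ne_top

end Finitary

theorem theorem1p1 (d : ℕ) (hd : 1 ≤ d)
    {Ω : Type*} [MeasurableSpace Ω] (P : Measure Ω) [IsProbabilityMeasure P]
    (p : NonemptyFinset d → ℝ) (hp_lt : ∀ A, p A < 1)
    (X : NonemptyFinset d → Ω → Bool) (hX_meas : ∀ A, Measurable (X A))
    (hX_indep : iIndepFun X P)
    (hX_law : ∀ A, P.real {ω | X A ω = true} = p A)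
    (hp_inv : ∀ (A : NonemptyFinset d) (v : IntLattice d), p (A.translate v) = p A)
    (hp_exp : ∀ l : ℝ, 0 < l →
      Summable fun A : OriginFinset d => p A.1 * Real.exp (l * (A.1.1.card : ℝ))) :
    IsFinitaryFactorOfIID P (unionProcess X) ∧
    (∀ᵐ ω ∂P, ∀ v, (selectedSets X v ω).Finite) ∧
    IsFinitaryFactorOfIID P (selectedProcess X) := by
  have hp0 : ∀ A, 0 ≤ p A := fun A => hX_law A ▸ measureReal_nonneg
  obtain ⟨level, T, h1, h2, h3, h4⟩ := exists_level hp0 hp_exp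
  have hL : IsLevel level T p := ⟨h1, h2, h3, h4, hp_inv⟩
  refine ⟨?_, ?_, ?_⟩
  · have h := hL.isFinitaryFactorOfIID hX_meas hX_indep hX_law hp_lt measurable_nonempty_set
    rw [unionProcess_eq]
    exact h
  · refine ae_finite_selectedSets hX_law hp_inv ((hp_exp 1 one_pos).of_nonneg_of_le
      (fun A => hp0 A.1) fun A => ?_)
    exact le_mul_of_one_le_right (hp0 A.1) (Real.one_le_exp (by positivity))
  · exact hL.isFinitaryFactorOfIID hX_meas hX_indep hX_law hp_lt measurable_toFinset_set
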